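/- Let $n\ge 1$ and $[n]=\{1,\dots,n\}$. **Paths.** An $n$-symmetric lattice path is a path from $(0,0)$ to $(n,n)$ with unit east steps $E$ and north steps $N$ that is invariant under reflection in the line $y=n-x$; as a word $\alpha_1\cdots\alpha_{2n}$ this means $\alpha_i\ne\alpha_{2n-i+1}$ for all $i$. Put $\operatorname{lab}(p)=\{i\in[n] : \alpha_{n+i}=E\}$. Write $p\le q$ if $p$ is weakly below $q$. A linked symmetric snake path is an interval $[p,q]$, $p\le q$, such that the skew diagram between $p$ and $q$ contains no $2\times2$ box and $p,q$ meet only at $(0,0)$ and $(n,n)$. Let $\Delta[p,q]$ be the delta matroid with feasible sets $\operatorname{lab}(r)$ for the $n$-symmetric paths $r$ with $p\le r\le q$. For $S,T\subseteq[n]$ let $\Delta[S,T]$ be the delta matroid with feasible sets $\{A : S\le A\le T\}$, where $A\le B$ in the type $C_n$ Gale order means that $|A|\le|B|$ and, for each $i\le |A|$, the $i$-th largest element of $A$ is at most the $i$-th largest element of $B$. The feasible polytope is $P(\Delta)=\operatorname{conv}(e_A : A \text{ feasible})\subset\mathbb R^n$. **The map $\varphi$.** For $w\in S_n$ let $\nabla_w=\{x\in\mathbb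 R^n : 0\le x_{w(1)}\le\cdots\le x_{w(n)}\le 1\}$. Let $\psi:[0,1]^n\to[0,1]^n$ be Stanley's map, $\psi_i(x)=(x_1+\cdots+x_i)-\lfloor x_1+\cdots+x_i\rfloor$, let $r(x_1,\dots,x_n)=(x_n,\dots,x_1)$ and $\varphi=r\circ\psi^{-1}$. On the interior of each $\nabla_w$ the map $\psi^{-1}$ is well defined and $\varphi$ is the affine map $x\mapsto y$ with $y_n=x_1$ and, for $1\le i\le n-1$, $y_{n-i}=x_{i+1}-x_i$ if $w^{-1}(i+1)>w^{-1}(i)$ and $y_{n-i}=x_{i+1}-x_i+1$ if $w^{-1}(i+1)<w^{-1}(i)$; $\varphi(\nabla_w)$ denotes the image of $\nabla_w$ under this affine map. For $w\in S_n$ let $\tilde w\in S_n$ be given by $\tilde w(j)=w^{-1}(n+1-j)$. The ascent set of $u\in S_n$ is $\operatorname{asc}(u)=\{i\in[n-1] : u(i)<u(i+1)\}$. **Theorem.** For every linked symmetric snake path $[p,q]$ there is a subset $S\subseteq[n-1]$ with $\operatorname{lab}(p)=S$, $\operatorname{lab}(q)=S\cup\{n\}$ and $\Delta[p,q]=\Delta[S,S\cup\{n\}]$,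 and every $S\subseteq[n-1]$ arises in this way. The map $\varphi$ induces a unimodular triangulation of the $n$-dimensional polytope $P(\Delta[p,q])$: the simplices $\varphi(\nabla_w)$ for the permutations $w$ with $\operatorname{asc}(\tilde w)=S$ are $n$-dimensional simplices with vertices in $\mathbb Z^n$ and volume $1/n!$, their union is $P(\Delta[p,q])$, and any two of them meet in a (possibly empty) common face. For every $w\in S_n$, $\varphi(\nabla_w)\subseteq P(\Delta[p,q])$ if and only if $\operatorname{asc}(\tilde w)=S$. Consequently these maximal simplices are in bijection with the permutations $u$ with ascent set $S$, where $u=\tilde w$ corresponds to $\varphi(\nabla_w)$. -/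

import Mathlib

/-! The set `[n] = {1, …, n}` is modelled by `Fin n`; the element `i` of `[n]` is the element of
`Fin n` with value `i - 1`. -/

namespace SnakePath

/-! ### Lattice paths -/

/-- The two kinds of unit steps: east `(1,0)` and north `(0,1)`. -/
inductive Step where
  | E : Step
  | N : Step
  deriving DecidableEq

/-- A lattice path from `(0,0)` to `(a,b)`: a word of `a + b` steps, exactly `a` of which go east
(hence exactly `b` go north). -/
structure LatticePath (a b : ℕ) where
  word : Fin (a + b) → Step
  east_card : (Finset.univ.filter fun i => word i = Step.E).card = a

/-- The lattice point `(x, y)` reached by a path after its first `k` steps. -/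
def LatticePath.point {a b : ℕ} (p : LatticePath a b) (k : ℕ) : ℕ × ℕ :=
  ((Finset.univ.filter fun i : Fin (a + b) => i.val < k ∧ p.word i = Step.E).card,
   (Finset.univ.filter fun i : Fin (a + b) => i.val < k ∧ p.word i = Step.N).card)

/-- The lattice points on a path. -/
def LatticePath.points {a b : ℕ} (p : LatticePath a b) : Set (ℕ × ℕ) :=
  {z | ∃ k : ℕ, k ≤ a + b ∧ z = p.point k}

/-- `p ≤ q`: the path `p` is weakly below `q`. The `k`-th points of the two paths lie on the common
antidiagonal `x + y = k`, and the one of `p` is not above the one of `q`. -/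
def LatticePath.WeaklyBelow {a b : ℕ} (p q : LatticePath a b) : Prop :=
  ∀ k : ℕ, k ≤ a + b → (p.point k).2 ≤ (q.point k).2

/-- The Young diagram below a path. The pair `(c, d)` stands for the unit box
`[c, c+1] × [d, d+1]`; it is below the path when the path crosses column `c` at a height of at
least `d + 1`. -/
def LatticePath.diagram {a b : ℕ} (p : LatticePath a b) : Set (ℕ × ℕ) :=
  {z | ∃ k : Fin (a + b), p.word k = Step.E ∧ (p.point k.val).1 = z.1 ∧ z.2 < (p.point k.val).2}

/-- The skew diagram between two paths `p` (lower) and `q` (upper). -/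
def LatticePath.skewDiagram {a b : ℕ} (p q : LatticePath a b) : Set (ℕ × ℕ) :=
  q.diagram \ p.diagram

/-- An `n`-symmetric lattice path: a path from `(0,0)` to `(n,n)` that is invariant under the
reflection in the line `y = n - x`. The reflection exchanges east and north steps and reverses
their order. -/
structure SymmetricPath (n : ℕ) extends LatticePath n n where
  symm : ∀ i : Fin (n + n), word i ≠ word i.rev

/-- `[p, q]` is a symmetric snake path: `p ≤ q` and the skew diagram between `p` and `q` contains no
`2 × 2` box. -/
def IsSymmetricSnake {n : ℕ} (p q : SymmetricPath n) : Prop :=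
  p.WeaklyBelow q.toLatticePath ∧
  ¬ ∃ c d : ℕ,
    (c, d) ∈ p.skewDiagram q.toLatticePath ∧ (c + 1, d) ∈ p.skewDiagram q.toLatticePath ∧
    (c, d + 1) ∈ p.skewDiagram q.toLatticePath ∧ (c + 1, d + 1) ∈ p.skewDiagram q.toLatticePath

/-- The paths `p` and `q` meet only at `(0,0)` and `(n,n)`. -/
def IsLinked {n : ℕ} (p q : SymmetricPath n) : Prop :=
  ∀ z : ℕ × ℕ, z ∈ p.points → z ∈ q.points → z = (0, 0) ∨ z = (n, n)

/-! ### Lattice path delta matroids and their polytopes -/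

/-- The part in `[n]` of the label of a symmetric path, whose steps are labelled in order by
`-n, …, -1, 1, …, n`: the labels `i ∈ [n]` of the east steps. -/
def SymmetricPath.label {n : ℕ} (p : SymmetricPath n) : Finset (Fin n) :=
  Finset.univ.filter fun i => p.word (Fin.natAdd n i) = Step.E

/-- The feasible sets of the lattice path delta matroid `Δ[p, q]`. -/
def pathFeasible {n : ℕ} (p q : SymmetricPath n) : Set (Finset (Fin n)) :=
  {A | ∃ r : SymmetricPath n,
    p.WeaklyBelow r.toLatticePath ∧ r.WeaklyBelow q.toLatticePath ∧ A = r.label}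

/-- The type `C` Gale order on subsets of `[n]`: for `A = {a_1 < ⋯ < a_j}` and
`B = {b_1 < ⋯ < b_k}`, `A ≤ B` iff `j ≤ k` and the `i`-th largest element of `A` is at most the
`i`-th largest element of `B`, for all `i = 1, …, j`. -/
def GaleLE {n : ℕ} (A B : Finset (Fin n)) : Prop :=
  ∃ h : A.card ≤ B.card, ∀ i : Fin A.card,
    A.orderEmbOfFin rfl i.rev ≤ B.orderEmbOfFin rfl (Fin.castLE h i).rev

/-- The feasible sets of the delta matroid `Δ[S, T]`: the Gale interval from `S` to `T`. -/
def galeFeasible {n : ℕ} (S T : Finset (Fin n)) : Set (Finset (Fin n)) :=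
  {A | GaleLE S A ∧ GaleLE A T}

/-- The indicator vector `e_A`. -/
def indicatorVec {n : ℕ} (A : Finset (Fin n)) : Fin n → ℝ := fun i => if i ∈ A then 1 else 0

/-- The feasible polytope `conv (e_A | A feasible)`. -/
def feasiblePolytope {n : ℕ} (F : Set (Finset (Fin n))) : Set (Fin n → ℝ) :=
  convexHull ℝ (indicatorVec '' F)

/-! ### Unimodular triangulations -/

/-- `σ` is an `n`-dimensional simplex in `ℝⁿ` with vertices in `ℤⁿ`. -/
def IsLatticeSimplex {n : ℕ} (σ : Set (Fin n → ℝ)) : Prop :=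
  ∃ v : Fin (n + 1) → (Fin n → ℝ), AffineIndependent ℝ v ∧
    (∀ j i, ∃ m : ℤ, v j i = m) ∧ σ = convexHull ℝ (Set.range v)

/-- `T` is (the set of maximal simplices of) a unimodular triangulation of the full-dimensional
polytope `P ⊆ ℝⁿ`: finitely many `n`-dimensional lattice simplices of volume `1 / n!` with union
`P`, any two of which meet in a common face (`IsExposed` holds for the empty set as well). -/
structure IsUnimodularTriangulation {n : ℕ} (P : Set (Fin n → ℝ)) (T : Set (Set (Fin n → ℝ))) :
    Prop where
  dim_eq : Module.finrank ℝ (affineSpan ℝ P).direction = n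
  finite : T.Finite
  simplex : ∀ σ ∈ T, IsLatticeSimplex σ
  volume_eq : ∀ σ ∈ T, MeasureTheory.volume σ = ENNReal.ofReal (1 / (n.factorial : ℝ))
  union_eq : ⋃₀ T = P
  inter_face : ∀ σ ∈ T, ∀ τ ∈ T, IsExposed ℝ σ (σ ∩ τ) ∧ IsExposed ℝ τ (σ ∩ τ)

/-! ### The map `φ` -/

/-- The unit cube `[0,1]ⁿ`. -/
def cube (n : ℕ) : Set (Fin n → ℝ) := {x | ∀ i, 0 ≤ x i ∧ x i ≤ 1}

/-- The simplex `∇_w = {x | 0 ≤ x_{w(1)} ≤ ⋯ ≤ x_{w(n)} ≤ 1}`. -/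
def nabla {n : ℕ} (w : Equiv.Perm (Fin n)) : Set (Fin n → ℝ) :=
  {x | x ∈ cube n ∧ ∀ i j : Fin n, i ≤ j → x (w i) ≤ x (w j)}

/-- Stanley's map `ψ`, whose `i`-th coordinate is the fractional part of `x_1 + ⋯ + x_i`. -/
noncomputable def psi {n : ℕ} (x : Fin n → ℝ) : Fin n → ℝ :=
  fun i => Int.fract (∑ j ∈ Finset.Iic i, x j)

/-- The coordinate reversal `r`. -/
def reversal {n : ℕ} (x : Fin n → ℝ) : Fin n → ℝ := fun i => x i.rev

/-- The affine map which is the inverse of `ψ` on the simplex `∇_w`: `y_1 = x_1`, and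
`y_{i+1} = x_{i+1} - x_i`, plus `1` if `w⁻¹(i+1) < w⁻¹(i)`. -/
noncomputable def psiInv {n : ℕ} (w : Equiv.Perm (Fin n)) (x : Fin n → ℝ) : Fin n → ℝ :=
  fun j =>
    if j.val = 0 then x j
    else
      let i : Fin n := ⟨j.val - 1, lt_of_le_of_lt (Nat.sub_le _ _) j.isLt⟩
      x j - x i + if w⁻¹ j < w⁻¹ i then 1 else 0

/-- The affine piece of `φ = r ∘ ψ⁻¹` on the simplex `∇_w`. -/
noncomputable def phi {n : ℕ} (w : Equiv.Perm (Fin n)) (x : Fin n → ℝ) : Fin n → ℝ :=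
  reversal (psiInv w x)

/-- The simplex `φ(∇_w)`. -/
noncomputable def phiNabla {n : ℕ} (w : Equiv.Perm (Fin n)) : Set (Fin n → ℝ) :=
  phi w '' nabla w

/-- The ascent set of a permutation `u`: all `i ∈ [n - 1]` such that `u(i) < u(i+1)`. -/
def ascentSet {n : ℕ} (u : Equiv.Perm (Fin n)) : Finset (Fin n) :=
  Finset.univ.filter fun i => ∃ j : Fin n, j.val = i.val + 1 ∧ u i < u j

end SnakePath

/-!
A symmetric path is determined by its label `A`, and its height on each antidiagonal is, up to a
shift, one of the tail counts `#{i ∈ A | i ≥ m}` (`SymmetricPath.snd_point_left`,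
`SymmetricPath.snd_point_right`). Both "weakly below" and the type `C` Gale order compare tail
counts (`SymmetricPath.weaklyBelow_iff`, `galeLE_iff`). A `2 × 2` box appears exactly when two paths
are at least two diagonal steps apart (`LatticePath.no_box_iff`), so the linked symmetric snakes are
the pairs `p, q` with tail counts differing by exactly `1` at every `m < n` (`snake_linked_iff`). This
means `q.label = p.label ∪ {n}`, and the feasible sets are those whose tail counts exceed those of
`S = p.label` by `0` or `1` (`ribbonSets`).

Let `T` be the unimodular linear map that sends `y` to its tail sums. Then `x = T (y - e_S)` has
coordinates in `[0,1]` when `y = e_A` with `A` feasible, and the conditions `0 ≤ y_i ≤ 1` say that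
consecutive coordinates of `x` decrease or increase according to `S`. Hence the feasible polytope is
the image of the order polytope of a ribbon under `x ↦ e_S + T⁻¹ x`
(`feasiblePolytope_ribbonSets`). On `∇_w` the map `φ` is this same affine map, `S` being the ascent
set of `j ↦ w⁻¹(n + 1 - j)` (`phi_eq_ribbonMap`). The theorem thus reduces to the fact that the order
polytope is triangulated by the simplices `∇_w` of the compatible orderings `w`: sorting the
coordinates, with ties broken compatibly with `S`, gives the covering (`exists_mem_nabla`); the
inequalities that two orderings disagree on give supporting functionals of the common faces
(`isExposed_inter_phiNabla`); and the `n!` simplices `∇_w` dissect the cube and have equal volumes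
(`volume_nabla`). Finally, the tail sums of a point of the interior of `φ(∇_w)` have integer parts
which determine the ascent set, so no other `φ(∇_w)` lies in the polytope (`phiNabla_subset_iff`).
-/

namespace SnakePath

/-! ### Heights of lattice paths and boxes of their diagrams -/

theorem card_filter_val_lt_succ {N : ℕ} (P : Fin N → Prop) [DecidablePred P] (k : Fin N) :
    (Finset.univ.filter fun i : Fin N => i.val < k.val + 1 ∧ P i).card =
      (Finset.univ.filter fun i : Fin N => i.val < k.val ∧ P i).card + if P k then 1 else 0 := by
  have h : (Finset.univ.filter fun i : Fin N => i.val < k.val + 1 ∧ P i) =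
      (Finset.univ.filter fun i : Fin N => i.val < k.val ∧ P i) ∪ (if P k then {k} else ∅) := by
    ext i
    rcases eq_or_ne i k with rfl | hik
    · by_cases hP : P i <;> simp [hP]
    · by_cases hP : P k <;> simp [hP, hik, hik.le_iff_lt]
  rw [h, Finset.card_union_of_disjoint]
  · split_ifs <;> simp
  · split_ifs <;> simp

theorem LatticePath.fst_point_succ {a b : ℕ} (p : LatticePath a b) (k : Fin (a + b)) :
    (p.point (k.val + 1)).1 = (p.point k.val).1 + if p.word k = Step.E then 1 else 0 :=
  card_filter_val_lt_succ _ k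

theorem LatticePath.snd_point_succ {a b : ℕ} (p : LatticePath a b) (k : Fin (a + b)) :
    (p.point (k.val + 1)).2 = (p.point k.val).2 + if p.word k = Step.N then 1 else 0 :=
  card_filter_val_lt_succ _ k

theorem LatticePath.point_zero {a b : ℕ} (p : LatticePath a b) : p.point 0 = (0, 0) := by
  simp [LatticePath.point]

theorem LatticePath.fst_point_mono {a b : ℕ} (p : LatticePath a b) :
    Monotone fun k => (p.point k).1 := by
  intro k l h
  dsimp only [LatticePath.point]
  refine Finset.card_le_card fun i => ?_
  simp only [Finset.mem_filter, Finset.mem_univ, true_and]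
  exact fun hi => ⟨by omega, hi.2⟩

theorem LatticePath.snd_point_mono {a b : ℕ} (p : LatticePath a b) :
    Monotone fun k => (p.point k).2 := by
  intro k l h
  dsimp only [LatticePath.point]
  refine Finset.card_le_card fun i => ?_
  simp only [Finset.mem_filter, Finset.mem_univ, true_and]
  exact fun hi => ⟨by omega, hi.2⟩

theorem LatticePath.fst_point_le {a b : ℕ} (p : LatticePath a b) (k : ℕ) :
    (p.point k).1 ≤ a := by
  conv_rhs => rw [← p.east_card]
  dsimp only [LatticePath.point]
  refine Finset.card_le_card fun i => ?_
  simp only [Finset.mem_filter, Finset.mem_univ, true_and]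
  exact fun hi => hi.2

theorem LatticePath.fst_point_last {a b : ℕ} (p : LatticePath a b) :
    (p.point (a + b)).1 = a := by
  conv_rhs => rw [← p.east_card]
  simp [LatticePath.point]

theorem LatticePath.fst_add_snd_point {a b : ℕ} (p : LatticePath a b) {k : ℕ} (hk : k ≤ a + b) :
    (p.point k).1 + (p.point k).2 = k := by
  induction k with
  | zero => simp [p.point_zero]
  | succ k ih =>
    have h1 := p.fst_point_succ ⟨k, hk⟩
    have h2 := p.snd_point_succ ⟨k, hk⟩
    have h3 := ih (by omega)
    simp only at h1 h2
    rw [h1, h2]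
    cases h : p.word ⟨k, hk⟩ <;> simp <;> omega

theorem LatticePath.snd_point_succ_le {a b : ℕ} (p : LatticePath a b) {k : ℕ} (hk : k < a + b) :
    (p.point (k + 1)).2 ≤ (p.point k).2 + 1 := by
  have h2 := p.snd_point_succ ⟨k, hk⟩
  simp only at h2
  split_ifs at h2 <;> omega

theorem LatticePath.lt_of_mem_diagram {a b : ℕ} (p : LatticePath a b) {c d : ℕ}
    (h : (c, d) ∈ p.diagram) : c < a ∧ c + d + 1 ≤ a + b := by
  obtain ⟨k, hE, h1, h2⟩ := h
  have h3 := p.fst_point_succ k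
  have h4 := p.fst_point_le (k.val + 1)
  have h5 := p.fst_add_snd_point k.isLt.le
  rw [if_pos hE] at h3
  simp only at h1 h2
  omega

/-- A box belongs to the diagram of a path iff the path passes weakly above its upper left corner;
this is read off the point of the path on the antidiagonal through that corner. -/
theorem LatticePath.mem_diagram_iff {a b : ℕ} (p : LatticePath a b) {c d : ℕ}
    (hc : c < a) (hcd : c + d + 1 ≤ a + b) :
    (c, d) ∈ p.diagram ↔ d + 1 ≤ (p.point (c + d + 1)).2 := by
  have h5 := p.fst_add_snd_point hcd
  constructor
  · rintro ⟨k, -, h1, h2⟩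
    simp only at h1 h2
    have h3 := p.fst_add_snd_point k.isLt.le
    have h4 : (p.point (c + d + 1)).1 ≤ (p.point k.val).1 :=
      p.fst_point_mono (by omega : c + d + 1 ≤ k.val)
    omega
  · intro h
    -- the last time at which at most `c` east steps have been made
    have hex : ∃ k, c < (p.point (k + 1)).1 :=
      ⟨a + b - 1, by rw [Nat.sub_add_cancel (by omega), p.fst_point_last]; exact hc⟩
    classical
    have hk := Nat.find_spec hex
    have hmin : ∀ m, m < Nat.find hex → (p.point (m + 1)).1 ≤ c := fun m hm =>
      not_lt.mp (Nat.find_min hex hm)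
    have hle : Nat.find hex ≤ a + b - 1 := Nat.find_min' hex
      (by rw [Nat.sub_add_cancel (by omega), p.fst_point_last]; exact hc)
    generalize Nat.find hex = k at hk hmin hle
    have hkc : (p.point k).1 ≤ c := by
      rcases Nat.eq_zero_or_pos k with rfl | hpos
      · simp [p.point_zero]
      · have := hmin (k - 1) (by omega)
        rwa [Nat.sub_add_cancel hpos] at this
    have hkl : k < a + b := by omega
    have hs := p.fst_point_succ ⟨k, hkl⟩
    simp only at hs
    have hE : p.word ⟨k, hkl⟩ = Step.E := by
      by_contra hE
      rw [if_neg hE] at hs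
      omega
    rw [if_pos hE] at hs
    have hge : c + d + 1 ≤ k := by
      by_contra hlt
      have : (p.point (k + 1)).1 ≤ (p.point (c + d + 1)).1 :=
        p.fst_point_mono (by omega : k + 1 ≤ c + d + 1)
      omega
    have : (p.point (c + d + 1)).2 ≤ (p.point k).2 := p.snd_point_mono hge
    exact ⟨⟨k, hkl⟩, hE, by simp only; omega, by simp only; omega⟩

/-- The absence of `2 × 2` boxes means that the two paths are never two diagonal steps apart. -/
theorem LatticePath.no_box_iff {a b : ℕ} {p q : LatticePath a b} :
    (¬ ∃ c d : ℕ, (c, d) ∈ p.skewDiagram q ∧ (c + 1, d) ∈ p.skewDiagram q ∧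
      (c, d + 1) ∈ p.skewDiagram q ∧ (c + 1, d + 1) ∈ p.skewDiagram q) ↔
    ∀ k ≤ a + b, (q.point k).2 ≤ (p.point k).2 + 1 := by
  constructor
  · intro h k hk
    by_contra hlt
    refine h ⟨k - (p.point k).2 - 2, (p.point k).2, ?_⟩
    have hp := p.fst_add_snd_point hk
    have hq := q.fst_add_snd_point hk
    have hpa := p.fst_point_le k
    have hqN : (q.point k).2 ≤ b := by
      have h1 := q.fst_add_snd_point le_rfl
      have h2 := q.fst_point_last
      have h3 : (q.point k).2 ≤ (q.point (a + b)).2 := q.snd_point_mono hk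
      omega
    generalize hd : (p.point k).2 = d at *
    obtain ⟨c, rfl⟩ : ∃ c, k = c + d + 2 := ⟨k - d - 2, by omega⟩
    rw [show c + d + 2 - d - 2 = c by omega]
    have hq1 := q.snd_point_succ_le (k := c + d + 1) (by omega)
    have hq2 : (q.point (c + d + 2)).2 ≤ (q.point (c + d + 3)).2 := q.snd_point_mono (by omega)
    have hp1 : (p.point (c + d + 1)).2 ≤ (p.point (c + d + 2)).2 := p.snd_point_mono (by omega)
    have hp2 := p.snd_point_succ_le (k := c + d + 2) (by omega)
    simp only [LatticePath.skewDiagram, Set.mem_sdiff]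
    have e1 : c + 1 + d + 1 = c + d + 2 := by omega
    have e2 : c + (d + 1) + 1 = c + d + 2 := by omega
    have e3 : c + 1 + (d + 1) + 1 = c + d + 3 := by omega
    rw [q.mem_diagram_iff (by omega) (by omega), p.mem_diagram_iff (by omega) (by omega),
      q.mem_diagram_iff (by omega) (by omega), p.mem_diagram_iff (by omega) (by omega),
      q.mem_diagram_iff (by omega) (by omega), p.mem_diagram_iff (by omega) (by omega),
      q.mem_diagram_iff (by omega) (by omega), p.mem_diagram_iff (by omega) (by omega), e1, e2, e3]
    simp only [Nat.add_assoc, Nat.reduceAdd] at *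
    omega
  · rintro h ⟨c, d, -, ⟨h1, h2⟩, ⟨h3, -⟩, -⟩
    have h4 := q.lt_of_mem_diagram h1
    have h5 := q.lt_of_mem_diagram h3
    rw [p.mem_diagram_iff (by omega) (by omega)] at h2
    rw [q.mem_diagram_iff (by omega) (by omega)] at h3
    have := h (c + d + 2) (by omega)
    rw [show c + 1 + d + 1 = c + d + 2 by omega] at h2
    rw [show c + (d + 1) + 1 = c + d + 2 by omega] at h3
    omega

/-! ### Symmetric paths and the Gale order in terms of tail counts -/

/-- The number of elements of `A` with value at least `m`. -/
def tailCount {n : ℕ} (A : Finset (Fin n)) (m : ℕ) : ℕ :=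
  (A.filter fun i => m ≤ i.val).card

theorem tailCount_zero {n : ℕ} (A : Finset (Fin n)) : tailCount A 0 = A.card := by
  simp [tailCount]

theorem tailCount_eq_zero {n : ℕ} (A : Finset (Fin n)) {m : ℕ} (h : n ≤ m) :
    tailCount A m = 0 := by
  simp only [tailCount, Finset.card_eq_zero, Finset.filter_eq_empty_iff]
  intro i _
  omega

theorem tailCount_eq_succ_add {n : ℕ} (A : Finset (Fin n)) (m : Fin n) :
    tailCount A m.val = tailCount A (m.val + 1) + if m ∈ A then 1 else 0 := by
  have h : (A.filter fun i => m.val ≤ i.val) =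
      (A.filter fun i => m.val + 1 ≤ i.val) ∪ (if m ∈ A then {m} else ∅) := by
    ext i
    by_cases hm : m ∈ A
    · simp only [Finset.mem_filter, if_pos hm, Finset.mem_union, Finset.mem_singleton]
      constructor
      · rintro ⟨h1, h2⟩
        rcases h2.lt_or_eq with h | h
        · exact Or.inl ⟨h1, h⟩
        · exact Or.inr (Fin.ext h.symm)
      · rintro (⟨h1, h2⟩ | rfl)
        · exact ⟨h1, by omega⟩
        · exact ⟨hm, le_rfl⟩
    · simp only [Finset.mem_filter, if_neg hm, Finset.union_empty]
      refine and_congr_right fun hi => ?_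
      have : i.val ≠ m.val := fun h => hm (Fin.ext h ▸ hi)
      omega
  rw [tailCount, h, Finset.card_union_of_disjoint]
  · split_ifs <;> simp [tailCount]
  · split_ifs <;> simp

/-- A subset of `[n]` is determined by its tail counts. -/
theorem tailCount_injective {n : ℕ} {A B : Finset (Fin n)}
    (h : ∀ m, tailCount A m = tailCount B m) : A = B := by
  ext i
  have hA := tailCount_eq_succ_add A i
  have hB := tailCount_eq_succ_add B i
  rw [h, h] at hA
  split_ifs at hA hB <;> simp_all

theorem tailCount_insert_last {n : ℕ} (hn : 0 < n) (S : Finset (Fin n))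
    (hS : (⟨n - 1, Nat.sub_lt hn Nat.one_pos⟩ : Fin n) ∉ S) {m : ℕ} (hm : m < n) :
    tailCount (insert (⟨n - 1, Nat.sub_lt hn Nat.one_pos⟩ : Fin n) S) m = tailCount S m + 1 := by
  rw [tailCount, Finset.filter_insert, if_pos (by simp only; omega), Finset.card_insert_of_notMem]
  · rfl
  · simp [hS]

/-- In its first half, a symmetric path has made as many north steps after `k` steps as there are
labels among the last `k`. -/
theorem SymmetricPath.snd_point_left {n : ℕ} (p : SymmetricPath n) {k : ℕ} (hk : k ≤ n) :
    (p.point k).2 = tailCount p.label (n - k) := by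
  induction k with
  | zero => rw [p.point_zero, tailCount_eq_zero _ (by omega)]
  | succ k ih =>
    have h := p.snd_point_succ ⟨k, by omega⟩
    simp only at h
    have ht := tailCount_eq_succ_add p.label ⟨n - (k + 1), by omega⟩
    simp only at ht
    rw [h, ih (by omega), ht, show n - (k + 1) + 1 = n - k by omega]
    congr 1
    have hs := p.symm ⟨k, by omega⟩
    have he : Fin.rev (⟨k, by omega⟩ : Fin (n + n)) = Fin.natAdd n ⟨n - (k + 1), by omega⟩ := by
      ext; simp; omega
    rw [he] at hs
    simp only [SymmetricPath.label, Finset.mem_filter, Finset.mem_univ, true_and]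
    cases h1 : p.word ⟨k, by omega⟩ <;>
      cases h2 : p.word (Fin.natAdd n ⟨n - (k + 1), by omega⟩) <;> simp_all

theorem SymmetricPath.snd_point_right {n : ℕ} (p : SymmetricPath n) {k : ℕ} (hk : k ≤ n) :
    (p.point (n + k)).2 = k + tailCount p.label k := by
  induction k with
  | zero => simpa using p.snd_point_left le_rfl
  | succ k ih =>
    have h := p.snd_point_succ ⟨n + k, by omega⟩
    simp only at h
    have ht := tailCount_eq_succ_add p.label ⟨k, by omega⟩
    simp only at ht
    rw [← add_assoc, h, ih (by omega), ht]
    have he : (⟨n + k, by omega⟩ : Fin (n + n)) = Fin.natAdd n ⟨k, by omega⟩ := rfl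
    rw [he]
    simp only [SymmetricPath.label, Finset.mem_filter, Finset.mem_univ, true_and]
    cases h2 : p.word (Fin.natAdd n ⟨k, by omega⟩) <;> simp <;> omega

/-- A relation between the heights of two symmetric paths that is invariant under shifts is a relation
between tail counts. It may also depend on the distance `n - |k - n|` of the step `k` from the ends of
the path. -/
theorem SymmetricPath.forall_snd_point {n : ℕ} (p q : SymmetricPath n) (R : ℕ → ℕ → ℕ → Prop)
    (hR : ∀ m i j k, R m i j ↔ R m (k + i) (k + j)) :
    (∀ k ≤ n + n, R (n - (max k n - min k n)) (p.point k).2 (q.point k).2) ↔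
      ∀ m ≤ n, R (n - m) (tailCount p.label m) (tailCount q.label m) := by
  constructor
  · intro h m hm
    have := h (n + m) (by omega)
    rw [p.snd_point_right hm, q.snd_point_right hm, ← hR] at this
    convert this using 1
    omega
  · intro h k hk
    rcases le_total k n with hkn | hkn
    · rw [p.snd_point_left hkn, q.snd_point_left hkn]
      convert h (n - k) (by omega) using 1
      omega
    · obtain ⟨m, rfl⟩ := Nat.exists_eq_add_of_le hkn
      rw [p.snd_point_right (by omega), q.snd_point_right (by omega), ← hR]
      convert h m (by omega) using 1
      omega

theorem SymmetricPath.weaklyBelow_iff {n : ℕ} (p q : SymmetricPath n) :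
    p.WeaklyBelow q.toLatticePath ↔ ∀ m, tailCount p.label m ≤ tailCount q.label m := by
  have := p.forall_snd_point q (fun _ i j => i ≤ j) (by intros; omega)
  refine this.trans ⟨fun h m => ?_, fun h m _ => h m⟩
  rcases le_or_gt m n with hm | hm
  · exact h m hm
  · rw [tailCount_eq_zero _ hm.le, tailCount_eq_zero _ hm.le]

/-- A linked symmetric snake is a pair of paths that are exactly one diagonal step apart, except at
the two ends. -/
theorem snake_linked_iff {n : ℕ} (hn : 0 < n) (p q : SymmetricPath n) :
    (IsSymmetricSnake p q ∧ IsLinked p q) ↔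
      ∀ m < n, tailCount q.label m = tailCount p.label m + 1 := by
  have key := p.forall_snd_point q (fun d i j => (0 < d → j = i + 1) ∧ (d = 0 → j = i))
    (by intros; omega)
  have h1 : (IsSymmetricSnake p q ∧ IsLinked p q) ↔ ∀ k ≤ n + n,
      ((0 < n - (max k n - min k n) → (q.point k).2 = (p.point k).2 + 1) ∧
        (n - (max k n - min k n) = 0 → (q.point k).2 = (p.point k).2)) := by
    rw [IsSymmetricSnake, LatticePath.no_box_iff]
    constructor
    · rintro ⟨⟨h1, h2⟩, h3⟩ k hk
      have hp := p.fst_add_snd_point hk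
      have hq := q.fst_add_snd_point hk
      have a1 := h1 k hk
      have a2 := h2 k hk
      refine ⟨fun hpos => ?_, fun h0 => ?_⟩
      · by_contra hne
        have heq : p.point k = q.point k := Prod.ext (by omega) (by omega)
        have := h3 (p.point k) ⟨k, hk, rfl⟩ ⟨k, hk, heq⟩
        rcases this with h | h <;> rw [h] at hp <;> simp only at hp <;> omega
      · have : k = 0 ∨ k = n + n := by omega
        rcases this with rfl | rfl
        · rw [p.point_zero, q.point_zero]
        · have e1 := p.fst_point_last
          have e2 := q.fst_point_last
          omega
    · intro h
      have h' : ∀ k ≤ n + n, (p.point k).2 ≤ (q.point k).2 ∧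
          (q.point k).2 ≤ (p.point k).2 + 1 := by
        intro k hk
        have := h k hk
        omega
      refine ⟨⟨fun k hk => (h' k hk).1, fun k hk => (h' k hk).2⟩, ?_⟩
      rintro z ⟨k, hk, rfl⟩ ⟨l, hl, hz⟩
      have hp := p.fst_add_snd_point hk
      have hq := q.fst_add_snd_point hl
      rw [← hz] at hq
      obtain rfl : k = l := by omega
      have := h k hk
      rw [← hz] at this
      have : k = 0 ∨ k = n + n := by omega
      rcases this with rfl | rfl
      · exact Or.inl p.point_zero
      · have e1 := p.fst_point_last
        exact Or.inr (Prod.ext e1 (by simp only; omega))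
  rw [h1]
  refine key.trans ⟨fun h m hm => (h m hm.le).1 (by omega), fun h m hm => ?_⟩
  refine ⟨fun hpos => h m (by omega), fun h0 => ?_⟩
  rw [tailCount_eq_zero _ (by omega), tailCount_eq_zero _ (by omega)]

/-- The symmetric path with a given label. -/
def pathOfLabel {n : ℕ} (A : Finset (Fin n)) : SymmetricPath n where
  word := Fin.addCases (fun i => if i.rev ∈ A then Step.N else Step.E)
    (fun i => if i ∈ A then Step.E else Step.N)
  east_card := by
    rw [Finset.card_filter, Fin.sum_univ_add]
    simp only [Fin.addCases_left, Fin.addCases_right]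
    rw [← Equiv.sum_comp Fin.revPerm, ← Finset.sum_add_distrib]
    simp only [Fin.revPerm_apply, Fin.rev_rev]
    rw [Finset.sum_congr rfl (g := fun _ => 1)]
    · simp
    · intro i _
      by_cases h : i ∈ A <;> simp [h]
  symm := by
    intro i
    refine Fin.addCases (fun i => ?_) (fun i => ?_) i
    · have he : Fin.rev (Fin.castAdd n i) = Fin.natAdd n i.rev := by ext; simp; omega
      rw [he, Fin.addCases_left, Fin.addCases_right]
      by_cases h : i.rev ∈ A <;> simp [h]
    · have he : Fin.rev (Fin.natAdd n i) = Fin.castAdd n i.rev := by ext; simp; omega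
      rw [he, Fin.addCases_left, Fin.addCases_right, Fin.rev_rev]
      by_cases h : i ∈ A <;> simp [h]

theorem label_pathOfLabel {n : ℕ} (A : Finset (Fin n)) : (pathOfLabel A).label = A := by
  ext i
  simp only [SymmetricPath.label, pathOfLabel, Fin.addCases_right, Finset.mem_filter,
    Finset.mem_univ, true_and]
  by_cases h : i ∈ A <;> simp [h]

theorem mem_pathFeasible_iff {n : ℕ} {p q : SymmetricPath n} {A : Finset (Fin n)} :
    A ∈ pathFeasible p q ↔ ∀ m, tailCount p.label m ≤ tailCount A m ∧
      tailCount A m ≤ tailCount q.label m := by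
  constructor
  · rintro ⟨r, h1, h2, rfl⟩ m
    exact ⟨(p.weaklyBelow_iff r).1 h1 m, (r.weaklyBelow_iff q).1 h2 m⟩
  · intro h
    refine ⟨pathOfLabel A, (p.weaklyBelow_iff _).2 ?_, (SymmetricPath.weaklyBelow_iff _ q).2 ?_,
      (label_pathOfLabel A).symm⟩ <;> rw [label_pathOfLabel]
    exacts [fun m => (h m).1, fun m => (h m).2]

/-- The element with `i` larger elements in `A` is at least `m` iff more than `i` elements of `A`
are. -/
theorem le_orderEmbOfFin_rev_iff {n : ℕ} (A : Finset (Fin n)) (i : Fin A.card) (m : ℕ) :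
    m ≤ (A.orderEmbOfFin rfl i.rev).val ↔ i.val < tailCount A m := by
  have hcard : tailCount A m =
      (Finset.univ.filter fun j : Fin A.card => m ≤ (A.orderEmbOfFin rfl j).val).card := by
    rw [tailCount, ← Finset.card_map (A.orderEmbOfFin rfl).toEmbedding]
    congr 1
    conv_lhs => rw [← Finset.map_orderEmbOfFin_univ A rfl, Finset.filter_map]
    rfl
  rw [hcard]
  constructor
  · intro h
    calc i.val < (Finset.Ici i.rev).card := by rw [Fin.card_Ici]; simp; omega
      _ ≤ _ := Finset.card_le_card fun j hj => by
        rw [Finset.mem_Ici] at hj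
        simp only [Finset.mem_filter, Finset.mem_univ, true_and]
        exact h.trans ((A.orderEmbOfFin rfl).monotone hj)
  · intro h
    by_contra hlt
    have : (Finset.univ.filter fun j : Fin A.card => m ≤ (A.orderEmbOfFin rfl j).val).card ≤
        (Finset.Ioi i.rev).card := Finset.card_le_card fun j hj => by
      simp only [Finset.mem_filter, Finset.mem_univ, true_and] at hj
      rw [Finset.mem_Ioi]
      by_contra hji
      exact hlt (hj.trans ((A.orderEmbOfFin rfl).monotone (not_lt.mp hji)))
    rw [Fin.card_Ioi] at this
    simp at this
    omega

/-- The type `C` Gale order compares tail counts. -/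
theorem galeLE_iff {n : ℕ} (A B : Finset (Fin n)) :
    GaleLE A B ↔ ∀ m, tailCount A m ≤ tailCount B m := by
  constructor
  · rintro ⟨h, hle⟩ m
    by_contra hlt
    have hA : tailCount A m ≤ A.card := Finset.card_le_card (Finset.filter_subset _ _)
    have hpos : 0 < tailCount A m := by omega
    have h1 := (le_orderEmbOfFin_rev_iff A ⟨tailCount A m - 1, by omega⟩ m).2 (by simp only; omega)
    have h2 := (le_orderEmbOfFin_rev_iff B _ m).1 (h1.trans (hle _))
    simp only [Fin.val_castLE] at h2
    omega
  · intro h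
    have hc : A.card ≤ B.card := by simpa only [tailCount_zero] using h 0
    refine ⟨hc, fun i => ?_⟩
    have h1 := (le_orderEmbOfFin_rev_iff A i _).1 le_rfl
    exact (le_orderEmbOfFin_rev_iff B (Fin.castLE hc i) _).2 (h1.trans_le (h _))

theorem label_eq_insert_of_snake_linked {n : ℕ} (hn : 0 < n) {p q : SymmetricPath n}
    (h : ∀ m < n, tailCount q.label m = tailCount p.label m + 1) :
    (⟨n - 1, Nat.sub_lt hn Nat.one_pos⟩ : Fin n) ∉ p.label ∧
      q.label = insert (⟨n - 1, Nat.sub_lt hn Nat.one_pos⟩ : Fin n) p.label := by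
  have hp := tailCount_eq_succ_add p.label ⟨n - 1, Nat.sub_lt hn Nat.one_pos⟩
  have hq := tailCount_eq_succ_add q.label ⟨n - 1, Nat.sub_lt hn Nat.one_pos⟩
  simp only at hp hq
  rw [tailCount_eq_zero _ (by omega : n ≤ n - 1 + 1)] at hp hq
  have h1 := h (n - 1) (by omega)
  rw [hp, hq] at h1
  have hS : (⟨n - 1, Nat.sub_lt hn Nat.one_pos⟩ : Fin n) ∉ p.label := by
    intro hmem
    rw [if_pos hmem] at h1
    split_ifs at h1 <;> omega
  refine ⟨hS, tailCount_injective fun m => ?_⟩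
  rcases lt_or_ge m n with hm | hm
  · rw [tailCount_insert_last hn _ hS hm, h m hm]
  · rw [tailCount_eq_zero _ hm, tailCount_eq_zero _ hm]

/-! ### The simplices `∇_w` -/

theorem perm_eq_one_of_monotone {n : ℕ} (u : Equiv.Perm (Fin n)) (hu : Monotone u) : u = 1 := by
  have hs : StrictMono u := hu.strictMono_of_injective u.injective
  have : hs.orderIsoOfSurjective u u.surjective = OrderIso.refl (Fin n) := Subsingleton.elim _ _
  ext i
  exact congrArg Fin.val (DFunLike.congr_fun this i)

theorem mem_nabla_iff {n : ℕ} {w : Equiv.Perm (Fin n)} {x : Fin n → ℝ} :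
    x ∈ nabla w ↔ x ∈ cube n ∧ ∀ a b, w⁻¹ a ≤ w⁻¹ b → x a ≤ x b := by
  refine and_congr_right fun _ => ⟨fun h a b hab => ?_, fun h i j hij => h _ _ (by simpa using hij)⟩
  simpa using h _ _ hab

/-- Two distinct permutations order some pair of coordinates differently. -/
theorem exists_inversion {n : ℕ} {w w' : Equiv.Perm (Fin n)} (h : w ≠ w') :
    ∃ a b, w⁻¹ a ≤ w⁻¹ b ∧ w'⁻¹ b < w'⁻¹ a := by
  by_contra! hcon
  refine h (inv_mul_eq_one.1 (perm_eq_one_of_monotone (w'⁻¹ * w) fun i j hij => ?_)).symm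
  exact hcon (w i) (w j) (by simpa using hij)

/-- An interior point of `∇_w`. -/
noncomputable def nablaCenter {n : ℕ} (w : Equiv.Perm (Fin n)) : Fin n → ℝ :=
  fun a => ((w⁻¹ a).val + 1) / (n + 1)

theorem nablaCenter_pos {n : ℕ} (w : Equiv.Perm (Fin n)) (a : Fin n) : 0 < nablaCenter w a := by
  unfold nablaCenter; positivity

theorem nablaCenter_lt_one {n : ℕ} (w : Equiv.Perm (Fin n)) (a : Fin n) :
    nablaCenter w a < 1 := by
  unfold nablaCenter
  rw [div_lt_one (by positivity)]
  have : ((w⁻¹ a).val : ℝ) < n := by exact_mod_cast (w⁻¹ a).isLt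
  linarith

theorem nablaCenter_le_iff {n : ℕ} (w : Equiv.Perm (Fin n)) (a b : Fin n) :
    nablaCenter w a ≤ nablaCenter w b ↔ w⁻¹ a ≤ w⁻¹ b := by
  unfold nablaCenter
  rw [div_le_div_iff_of_pos_right (by positivity), add_le_add_iff_right, Nat.cast_le, Fin.le_def]

theorem nablaCenter_mem {n : ℕ} (w : Equiv.Perm (Fin n)) : nablaCenter w ∈ nabla w :=
  mem_nabla_iff.2 ⟨fun a => ⟨(nablaCenter_pos w a).le, (nablaCenter_lt_one w a).le⟩,
    fun a b => (nablaCenter_le_iff w a b).2⟩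

theorem nabla_injective {n : ℕ} : Function.Injective (nabla (n := n)) := by
  intro w w' h
  by_contra hne
  obtain ⟨a, b, h1, h2⟩ := exists_inversion (Ne.symm hne)
  have hm : nablaCenter w ∈ nabla w' := h ▸ nablaCenter_mem w
  exact absurd ((nablaCenter_le_iff w a b).1 ((mem_nabla_iff.1 hm).2 a b h1)) (not_le.2 h2)

/-- In the interior of `∇_w` all inequalities are strict. -/
theorem interior_nabla {n : ℕ} {w : Equiv.Perm (Fin n)} {x : Fin n → ℝ}
    (hx : x ∈ interior (nabla w)) :
    (∀ a, 0 < x a ∧ x a < 1) ∧ ∀ a b, w⁻¹ a < w⁻¹ b → x a < x b := by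
  have key : ∀ a : Fin n, ∃ ε > 0, Function.update x a (x a + ε) ∈ nabla w ∧
      Function.update x a (x a - ε) ∈ nabla w := by
    intro a
    have hc : Continuous fun t : ℝ => Function.update x a t := by fun_prop
    have hmem : (fun t : ℝ => Function.update x a t) ⁻¹' (nabla w) ∈ nhds (x a) := by
      refine hc.continuousAt.preimage_mem_nhds ?_
      rw [Function.update_eq_self]
      exact mem_interior_iff_mem_nhds.1 hx
    obtain ⟨ε, hε, hb⟩ := Metric.mem_nhds_iff.1 hmem
    refine ⟨ε / 2, by positivity, hb ?_, hb ?_⟩ <;>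
      simp [abs_of_pos hε, hε]
  refine ⟨fun a => ?_, fun a b hab => ?_⟩
  · obtain ⟨ε, hε, h1, h2⟩ := key a
    have e1 := (h1.1 a).2
    have e2 := (h2.1 a).1
    rw [Function.update_self] at e1 e2
    exact ⟨by linarith, by linarith⟩
  · obtain ⟨ε, hε, h1, -⟩ := key a
    have hne : b ≠ a := fun h => by rw [h] at hab; exact lt_irrefl _ hab
    have := (mem_nabla_iff.1 h1).2 a b hab.le
    rw [Function.update_self, Function.update_of_ne hne] at this
    linarith

theorem convex_nabla {n : ℕ} (w : Equiv.Perm (Fin n)) : Convex ℝ (nabla w) := by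
  rintro x ⟨hx, hx'⟩ y ⟨hy, hy'⟩ s t hs ht hst
  refine ⟨fun i => ?_, fun i j hij => ?_⟩ <;> simp only [Pi.add_apply, Pi.smul_apply, smul_eq_mul]
  · have h1 := hx i
    have h2 := hy i
    constructor
    · exact add_nonneg (mul_nonneg hs h1.1) (mul_nonneg ht h2.1)
    · calc s * x i + t * y i ≤ s * 1 + t * 1 :=
          add_le_add (mul_le_mul_of_nonneg_left h1.2 hs) (mul_le_mul_of_nonneg_left h2.2 ht)
        _ = 1 := by linarith
  · exact add_le_add (mul_le_mul_of_nonneg_left (hx' i j hij) hs)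
      (mul_le_mul_of_nonneg_left (hy' i j hij) ht)

/-- The `k`-th vertex of `∇_w`: the coordinates `w(k), …, w(n-1)` (counted from `0`) are `1`, the
others are `0`. -/
def nablaVertex {n : ℕ} (w : Equiv.Perm (Fin n)) (k : Fin (n + 1)) : Fin n → ℝ :=
  fun a => if k.val ≤ (w⁻¹ a).val then 1 else 0

theorem nablaVertex_eq {n : ℕ} (w : Equiv.Perm (Fin n)) (k : Fin (n + 1)) (a : Fin n) :
    nablaVertex w k a = 0 ∨ nablaVertex w k a = 1 := by
  unfold nablaVertex
  split_ifs <;> simp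

theorem nablaVertex_mem {n : ℕ} (w : Equiv.Perm (Fin n)) (k : Fin (n + 1)) :
    nablaVertex w k ∈ nabla w := by
  refine mem_nabla_iff.2 ⟨fun a => ?_, fun a b hab => ?_⟩
  · rcases nablaVertex_eq w k a with h | h <;> rw [h] <;> norm_num
  · unfold nablaVertex
    rw [Fin.le_def] at hab
    split_ifs <;> first | omega | norm_num

/-- A linear combination of the vertices of `∇_w` has partial sums of its coefficients as
coordinates. -/
theorem sum_smul_nablaVertex {n : ℕ} (w : Equiv.Perm (Fin n)) (c : ℕ → ℝ) (a : Fin n) :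
    (∑ k : Fin (n + 1), c k • nablaVertex w k) a =
      ∑ k ∈ Finset.range ((w⁻¹ a).val + 1), c k := by
  rw [Finset.sum_apply]
  simp only [Pi.smul_apply, nablaVertex, smul_eq_mul, mul_ite, mul_one, mul_zero]
  rw [Fin.sum_univ_eq_sum_range (fun k => if k ≤ (w⁻¹ a).val then c k else 0) (n + 1),
    ← Finset.sum_filter]
  refine Finset.sum_congr ?_ fun _ _ => rfl
  ext k
  have := (w⁻¹ a).isLt
  simp only [Finset.mem_filter, Finset.mem_range]
  omega

theorem affineIndependent_nablaVertex {n : ℕ} (w : Equiv.Perm (Fin n)) :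
    AffineIndependent ℝ (nablaVertex w) := by
  rw [affineIndependent_iff]
  intro s c hc hs k hk
  -- extend the coefficients by zero
  let d : ℕ → ℝ := fun m =>
    if h : m < n + 1 then (if (⟨m, h⟩ : Fin (n + 1)) ∈ s then c ⟨m, h⟩ else 0) else 0
  have hd : ∀ j : Fin (n + 1), d j = if j ∈ s then c j else 0 := fun j => by
    simp only [d]
    rw [dif_pos j.isLt]
  have h1 : ∑ j : Fin (n + 1), d j = 0 := by
    simp only [hd]
    rw [← Finset.sum_filter, Finset.filter_mem_eq_inter, Finset.univ_inter]
    exact hc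
  have h2 : ∑ j : Fin (n + 1), d j • nablaVertex w j = 0 := by
    simp only [hd, ite_smul, zero_smul]
    rw [← Finset.sum_filter, Finset.filter_mem_eq_inter, Finset.univ_inter]
    exact hs
  have h3 : ∀ m ≤ n + 1, ∑ j ∈ Finset.range m, d j = 0 := by
    intro m hm
    rcases Nat.eq_zero_or_pos m with rfl | hpos
    · simp
    rcases hm.lt_or_eq with hlt | rfl
    · have := sum_smul_nablaVertex w d (w ⟨m - 1, by omega⟩)
      rw [h2, show w⁻¹ (w ⟨m - 1, by omega⟩) = ⟨m - 1, by omega⟩ by simp, Pi.zero_apply] at this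
      simp only at this
      rw [Nat.sub_add_cancel hpos] at this
      exact this.symm
    · rw [← Fin.sum_univ_eq_sum_range]
      exact h1
  have h4 : d k.val = 0 := by
    have e1 := h3 (k.val + 1) (by omega)
    rw [Finset.sum_range_succ, h3 k.val (by omega), zero_add] at e1
    exact e1
  rw [hd, if_pos hk] at h4
  exact h4

theorem nabla_eq_convexHull {n : ℕ} (w : Equiv.Perm (Fin n)) :
    nabla w = convexHull ℝ (Set.range (nablaVertex w)) := by
  refine subset_antisymm (fun x hx => ?_) (convexHull_min ?_ (convex_nabla w))
  · obtain ⟨hc, hm⟩ := hx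
    -- the sorted coordinates of `x`, framed by `0` and `1`; the barycentric coordinates are its
    -- successive differences
    let g : ℕ → ℝ := fun m => if m = 0 then 0 else if h : m - 1 < n then x (w ⟨m - 1, h⟩) else 1
    have g0 : g 0 = 0 := by simp [g]
    have gn : g (n + 1) = 1 := by simp [g]
    have gx : ∀ i : Fin n, g (i.val + 1) = x (w i) := fun i => by simp [g]
    have hg : ∀ m ≤ n, 0 ≤ g (m + 1) - g m := by
      intro m hmn
      rw [sub_nonneg]
      rcases Nat.eq_zero_or_pos m with rfl | hpos
      · rw [g0]
        rcases hmn.lt_or_eq with hlt | heq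
        · rw [gx ⟨0, hlt⟩]
          exact (hc _).1
        · rw [heq, gn]
          exact zero_le_one
      · obtain ⟨m, rfl⟩ : ∃ m', m = m' + 1 := ⟨m - 1, by omega⟩
        rw [gx ⟨m, by omega⟩]
        rcases hmn.lt_or_eq with hlt | heq
        · rw [gx ⟨m + 1, hlt⟩]
          exact hm _ _ (by simp [Fin.le_def])
        · rw [heq, gn]
          exact (hc _).2
    have hsum : ∑ k : Fin (n + 1), (g (k.val + 1) - g k.val) = 1 := by
      rw [Fin.sum_univ_eq_sum_range (fun k => g (k + 1) - g k), Finset.sum_range_sub, g0, gn,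
        sub_zero]
    have hx : x = ∑ k : Fin (n + 1), (g (k.val + 1) - g k.val) • nablaVertex w k := by
      ext a
      rw [sum_smul_nablaVertex w (fun k => g (k + 1) - g k), Finset.sum_range_sub, g0, sub_zero, gx]
      simp
    rw [hx]
    exact (convex_convexHull ℝ _).sum_mem (fun k _ => hg k (by omega)) hsum
      fun k _ => subset_convexHull ℝ _ ⟨k, rfl⟩
  · rintro _ ⟨k, rfl⟩
    exact nablaVertex_mem w k

/-! ### The volume of `∇_w` -/

theorem isClosed_nabla {n : ℕ} (w : Equiv.Perm (Fin n)) : IsClosed (nabla w) := by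
  simp only [nabla, cube, Set.ofPred_and, Set.ofPred_forall]
  refine IsClosed.inter ?_ ?_
  · exact isClosed_iInter fun i => (isClosed_le (by fun_prop) (by fun_prop)).inter
      (isClosed_le (by fun_prop) (by fun_prop))
  · exact isClosed_iInter fun i => isClosed_iInter fun j => isClosed_iInter fun _ =>
      isClosed_le (by fun_prop) (by fun_prop)

theorem volume_setOf_eq {n : ℕ} {a b : Fin n} (hab : a ≠ b) :
    MeasureTheory.volume {x : Fin n → ℝ | x a = x b} = 0 := by
  let l : (Fin n → ℝ) →ₗ[ℝ] ℝ := (LinearMap.proj a : (Fin n → ℝ) →ₗ[ℝ] ℝ) - LinearMap.proj b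
  have h : {x : Fin n → ℝ | x a = x b} = (LinearMap.ker l : Set (Fin n → ℝ)) := by
    ext x
    simp [l, sub_eq_zero]
  rw [h]
  refine MeasureTheory.Measure.addHaar_submodule _ _ fun htop => ?_
  have : (Pi.single a 1 : Fin n → ℝ) ∈ LinearMap.ker l := htop ▸ Submodule.mem_top
  simp [l, hab.symm] at this

theorem volume_nabla_eq {n : ℕ} (w : Equiv.Perm (Fin n)) :
    MeasureTheory.volume (nabla w) = MeasureTheory.volume (nabla (1 : Equiv.Perm (Fin n))) := by
  have hmp := MeasureTheory.volume_measurePreserving_piCongrLeft (fun _ : Fin n => ℝ) w⁻¹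
  rw [← hmp.measure_preimage_equiv (nabla 1)]
  congr 1
  ext x
  have hx : ∀ i, MeasurableEquiv.piCongrLeft (fun _ : Fin n => ℝ) w⁻¹ x i = x (w i) := by
    intro i
    have := MeasurableEquiv.piCongrLeft_apply_apply (β := fun _ : Fin n => ℝ) (e := w⁻¹) x (w i)
    simpa using this
  simp only [Set.mem_preimage, nabla, cube, Set.mem_ofPred_eq, hx, Equiv.Perm.one_apply]
  exact and_congr_left' ⟨fun h i => h _, fun h i => by simpa using h (w⁻¹ i)⟩

theorem cube_eq_iUnion_nabla (n : ℕ) : cube n = ⋃ w : Equiv.Perm (Fin n), nabla w := by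
  ext x
  rw [Set.mem_iUnion]
  exact ⟨fun h => ⟨Tuple.sort x, h, fun i j hij => Tuple.monotone_sort x hij⟩, fun ⟨w, h⟩ => h.1⟩

/-- The `n!` simplices `∇_w` are exchanged by permutations of the coordinates and dissect the unit
cube. -/
theorem volume_nabla {n : ℕ} (w : Equiv.Perm (Fin n)) :
    MeasureTheory.volume (nabla w) = ENNReal.ofReal (1 / (n.factorial : ℝ)) := by
  have hcube : MeasureTheory.volume (cube n) = 1 := by
    have : cube n = Set.Icc (fun _ => 0) (fun _ => 1) := by
      ext x
      simp [cube, Set.mem_Icc, Pi.le_def, forall_and]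
    rw [this, Real.volume_Icc_pi]
    simp
  have hdisj : Pairwise (Function.onFun (MeasureTheory.AEDisjoint MeasureTheory.volume)
      (nabla (n := n))) := by
    intro u v huv
    obtain ⟨a, b, h1, h2⟩ := exists_inversion huv
    refine MeasureTheory.measure_mono_null ?_ (volume_setOf_eq (a := a) (b := b) ?_)
    · rintro x ⟨hu, hv⟩
      exact le_antisymm ((mem_nabla_iff.1 hu).2 _ _ h1) ((mem_nabla_iff.1 hv).2 _ _ h2.le)
    · rintro rfl
      exact lt_irrefl _ h2
  have hsum := MeasureTheory.measure_iUnion₀ hdisj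
    fun u => (isClosed_nabla u).measurableSet.nullMeasurableSet
  rw [← cube_eq_iUnion_nabla, hcube, tsum_fintype,
    Finset.sum_congr rfl fun u _ => (volume_nabla_eq u).trans (volume_nabla_eq w).symm,
    Finset.sum_const, Finset.card_univ, Fintype.card_perm, Fintype.card_fin, nsmul_eq_mul] at hsum
  rw [one_div, ENNReal.ofReal_inv_of_pos (by positivity), ENNReal.ofReal_natCast]
  exact ENNReal.eq_inv_of_mul_eq_one_left (by rw [mul_comm]; exact hsum.symm)

/-! ### Tail sums -/

/-- The matrix of `tailSum`. -/
def tailMatrix (n : ℕ) : Matrix (Fin n) (Fin n) ℝ :=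
  Matrix.of fun i j => if i.rev ≤ j then 1 else 0

theorem abs_det_tailMatrix (n : ℕ) : |(tailMatrix n).det| = 1 := by
  have h : tailMatrix n =
      (Matrix.of fun i j : Fin n => if i ≤ j then (1 : ℝ) else 0).submatrix Fin.revPerm id := by
    ext i j
    simp [tailMatrix]
  rw [h, Matrix.det_permute, abs_mul, Matrix.det_of_isUpperTriangular]
  · simp
    rcases Int.units_eq_one_or (Equiv.Perm.sign (Fin.revPerm : Equiv.Perm (Fin n))) with h | h <;>
      simp [h]
  · intro i j hij
    simpa using hij

/-- The sums of the last coordinates: the entry of index `i` is the sum of the last `i + 1`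
coordinates. -/
def tailSum (n : ℕ) : (Fin n → ℝ) →ₗ[ℝ] (Fin n → ℝ) := Matrix.toLin' (tailMatrix n)

theorem tailSum_apply {n : ℕ} (y : Fin n → ℝ) (i : Fin n) :
    tailSum n y i = ∑ j ∈ Finset.Ici i.rev, y j := by
  simp [tailSum, tailMatrix, Matrix.mulVec, dotProduct, ← Finset.sum_filter,
    Finset.filter_le_eq_Ici]

/-- The consecutive differences of the coordinates, in reversed order. This map and `tailSum` are
inverse to each other. -/
def revDiff {n : ℕ} (x : Fin n → ℝ) : Fin n → ℝ :=
  fun i => x i.rev -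
    if i.rev.val = 0 then 0 else x ⟨i.rev.val - 1, lt_of_le_of_lt (Nat.sub_le _ _) i.rev.isLt⟩

theorem revDiff_tailSum {n : ℕ} (y : Fin n → ℝ) : revDiff (tailSum n y) = y := by
  ext i
  simp only [revDiff, tailSum_apply, Fin.rev_rev]
  rw [← Finset.Ioi_insert, Finset.sum_insert (by simp)]
  have : ∑ j ∈ Finset.Ioi i, y j = if i.rev.val = 0 then 0 else
      ∑ j ∈ Finset.Ici
        (Fin.rev ⟨i.rev.val - 1, lt_of_le_of_lt (Nat.sub_le _ _) i.rev.isLt⟩), y j := by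
    split_ifs with h
    · refine Finset.sum_eq_zero fun j hj => ?_
      rw [Finset.mem_Ioi, Fin.lt_def] at hj
      rw [Fin.val_rev] at h
      omega
    · refine Finset.sum_congr ?_ fun _ _ => rfl
      ext j
      rw [Fin.val_rev] at h
      simp only [Finset.mem_Ioi, Finset.mem_Ici, Fin.lt_def, Fin.le_def, Fin.val_rev]
      omega
  rw [this]
  ring

/-- `tailSum` as a linear equivalence. -/
noncomputable def tailEquiv (n : ℕ) : (Fin n → ℝ) ≃ₗ[ℝ] (Fin n → ℝ) :=
  LinearEquiv.ofInjectiveEndo (tailSum n) (Function.LeftInverse.injective revDiff_tailSum)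

theorem tailEquiv_apply {n : ℕ} (y : Fin n → ℝ) (i : Fin n) :
    tailEquiv n y i = ∑ j ∈ Finset.Ici i.rev, y j := tailSum_apply y i

theorem tailEquiv_symm_apply {n : ℕ} (x : Fin n → ℝ) : (tailEquiv n).symm x = revDiff x := by
  obtain ⟨y, rfl⟩ := (tailEquiv n).surjective x
  rw [LinearEquiv.symm_apply_apply]
  exact (revDiff_tailSum y).symm

theorem tailEquiv_indicatorVec {n : ℕ} (A : Finset (Fin n)) (i : Fin n) :
    tailEquiv n (indicatorVec A) i = tailCount A i.rev.val := by
  rw [tailEquiv_apply]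
  simp only [indicatorVec, tailCount]
  rw [← Finset.sum_filter, Finset.sum_const, nsmul_one]
  congr 2
  ext j
  simp [Fin.le_def, and_comm]

/-- `revDiff` preserves volumes. -/
theorem volume_tailEquiv_symm_image {n : ℕ} (s : Set (Fin n → ℝ)) :
    MeasureTheory.volume ((tailEquiv n).symm '' s) = MeasureTheory.volume s := by
  have hdet : |LinearMap.det (tailEquiv n : (Fin n → ℝ) →ₗ[ℝ] (Fin n → ℝ))| = 1 := by
    have : (tailEquiv n : (Fin n → ℝ) →ₗ[ℝ] (Fin n → ℝ)) = tailSum n := rfl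
    rw [this, tailSum, LinearMap.det_toLin', abs_det_tailMatrix]
  have hdet' : |LinearMap.det ((tailEquiv n).symm : (Fin n → ℝ) →ₗ[ℝ] (Fin n → ℝ))| = 1 := by
    have := congrArg abs (LinearEquiv.det_symm_mul_det (tailEquiv n))
    rwa [abs_mul, hdet, mul_one, abs_one] at this
  have := MeasureTheory.Measure.addHaar_image_linearMap MeasureTheory.volume
    ((tailEquiv n).symm : (Fin n → ℝ) →ₗ[ℝ] (Fin n → ℝ)) s
  rw [hdet', ENNReal.ofReal_one, one_mul] at this
  exact this

/-! ### The affine pieces of `φ` -/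

theorem revDiff_zero {n : ℕ} (x : Fin n → ℝ) {j : Fin n} (hj : j.val = 0) :
    revDiff x j.rev = x j := by
  simp only [revDiff, Fin.rev_rev, if_pos hj, sub_zero]

theorem revDiff_succ {n : ℕ} (x : Fin n → ℝ) {i j : Fin n} (hij : j.val = i.val + 1) :
    revDiff x j.rev = x j - x i := by
  simp only [revDiff, Fin.rev_rev]
  rw [if_neg (by omega)]
  congr 2
  ext
  simp only
  omega

/-- Every index is either the first one or the successor of another one. -/
theorem eq_zero_or_succ {n : ℕ} (j : Fin n) : j.val = 0 ∨ ∃ i : Fin n, j.val = i.val + 1 := by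
  rcases Nat.eq_zero_or_pos j.val with h | h
  · exact Or.inl h
  · exact Or.inr ⟨⟨j.val - 1, by omega⟩, by simp only; omega⟩

/-- The affine map `x ↦ e_S + revDiff x`; its inverse takes tail sums and subtracts those of
`e_S`. -/
noncomputable def ribbonMap {n : ℕ} (S : Finset (Fin n)) :
    (Fin n → ℝ) ≃ᵃ[ℝ] (Fin n → ℝ) :=
  (tailEquiv n).symm.toAffineEquiv.trans (AffineEquiv.constVAdd ℝ (Fin n → ℝ) (indicatorVec S))

theorem ribbonMap_apply {n : ℕ} (S : Finset (Fin n)) (x : Fin n → ℝ) :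
    ribbonMap S x = indicatorVec S + (tailEquiv n).symm x := rfl

theorem ribbonMap_apply' {n : ℕ} (S : Finset (Fin n)) (x : Fin n → ℝ) (i : Fin n) :
    ribbonMap S x i = indicatorVec S i + revDiff x i := by
  rw [ribbonMap_apply, tailEquiv_symm_apply, Pi.add_apply]

theorem tailEquiv_ribbonMap {n : ℕ} (S : Finset (Fin n)) (x : Fin n → ℝ) (i : Fin n) :
    tailEquiv n (ribbonMap S x) i = tailCount S i.rev.val + x i := by
  rw [ribbonMap_apply, map_add, LinearEquiv.apply_symm_apply, Pi.add_apply, tailEquiv_indicatorVec]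

theorem rev_notMem_ascentSet {n : ℕ} (u : Equiv.Perm (Fin n)) {j : Fin n} (hj : j.val = 0) :
    j.rev ∉ ascentSet u := by
  simp only [ascentSet, Finset.mem_filter, Finset.mem_univ, true_and, not_exists, not_and]
  intro k hk
  rw [Fin.val_rev] at hk
  omega

theorem rev_mem_ascentSet_iff {n : ℕ} (w : Equiv.Perm (Fin n)) {i j : Fin n}
    (hij : j.val = i.val + 1) :
    j.rev ∈ ascentSet (w⁻¹ * Fin.revPerm) ↔ w⁻¹ j < w⁻¹ i := by
  simp only [ascentSet, Finset.mem_filter, Finset.mem_univ, true_and, Equiv.Perm.mul_apply,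
    Fin.revPerm_apply, Fin.rev_rev]
  constructor
  · rintro ⟨k, hk, h⟩
    have : k.rev = i := by
      ext
      rw [Fin.val_rev] at hk ⊢
      omega
    rwa [this] at h
  · intro h
    refine ⟨i.rev, ?_, by rwa [Fin.rev_rev]⟩
    rw [Fin.val_rev, Fin.val_rev]
    omega

/-- The affine piece of `φ` on `∇_w` depends only on the ascent set of `j ↦ w⁻¹(n + 1 - j)`. -/
theorem phi_eq_ribbonMap {n : ℕ} (w : Equiv.Perm (Fin n)) :
    phi w = ribbonMap (ascentSet (w⁻¹ * Fin.revPerm)) := by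
  ext x i
  obtain ⟨j, rfl⟩ := Fin.rev_surjective i
  rw [ribbonMap_apply']
  simp only [phi, reversal, psiInv, Fin.rev_rev, indicatorVec]
  rcases eq_zero_or_succ j with hj | ⟨i, hij⟩
  · rw [if_pos hj, if_neg (rev_notMem_ascentSet _ hj), revDiff_zero x hj, zero_add]
  · have hi : (⟨j.val - 1, lt_of_le_of_lt (Nat.sub_le _ _) j.isLt⟩ : Fin n) = i := by
      ext
      simp only
      omega
    rw [if_neg (by omega), revDiff_succ x hij, hi]
    simp only [rev_mem_ascentSet_iff w hij]
    ring

theorem phiNabla_eq {n : ℕ} (w : Equiv.Perm (Fin n)) :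
    phiNabla w = ribbonMap (ascentSet (w⁻¹ * Fin.revPerm)) '' nabla w := by
  rw [phiNabla, phi_eq_ribbonMap]

/-! ### `φ` inverts Stanley's map -/

theorem sum_Iic_succ {n : ℕ} (y : Fin n → ℝ) {i j : Fin n} (hij : j.val = i.val + 1) :
    ∑ k ∈ Finset.Iic j, y k = ∑ k ∈ Finset.Iic i, y k + y j := by
  rw [← Finset.Iio_insert, Finset.sum_insert (by simp), add_comm]
  congr 2
  ext k
  simp only [Finset.mem_Iio, Finset.mem_Iic, Fin.lt_def, Fin.le_def]
  omega

theorem sum_Iic_zero {n : ℕ} (y : Fin n → ℝ) {j : Fin n} (hj : j.val = 0) :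
    ∑ k ∈ Finset.Iic j, y k = y j := by
  rw [Finset.sum_eq_single_of_mem j (by simp)]
  intro b hb hne
  rw [Finset.mem_Iic, Fin.le_def] at hb
  exact absurd (Fin.ext (by omega)) hne

theorem psiInv_zero {n : ℕ} (w : Equiv.Perm (Fin n)) (x : Fin n → ℝ) {j : Fin n}
    (hj : j.val = 0) : psiInv w x j = x j := by
  simp only [psiInv, if_pos hj]

theorem psiInv_succ {n : ℕ} (w : Equiv.Perm (Fin n)) (x : Fin n → ℝ) {i j : Fin n}
    (hij : j.val = i.val + 1) :
    psiInv w x j = x j - x i + if w⁻¹ j < w⁻¹ i then 1 else 0 := by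
  have hi : (⟨j.val - 1, lt_of_le_of_lt (Nat.sub_le _ _) j.isLt⟩ : Fin n) = i := by
    ext
    simp only
    omega
  simp only [psiInv, hi]
  rw [if_neg (by omega)]

/-- The partial sums of `psiInv w x` agree with `x` up to integers. -/
theorem exists_sum_Iic_psiInv {n : ℕ} (w : Equiv.Perm (Fin n)) (x : Fin n → ℝ) (j : Fin n) :
    ∃ m : ℤ, ∑ k ∈ Finset.Iic j, psiInv w x k = x j + m := by
  obtain ⟨j, hj⟩ := j
  induction j with
  | zero => exact ⟨0, by rw [sum_Iic_zero _ rfl, psiInv_zero w x rfl, Int.cast_zero, add_zero]⟩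
  | succ j ih =>
    obtain ⟨m, hm⟩ := ih (by omega)
    rw [sum_Iic_succ _ (i := ⟨j, by omega⟩) rfl, hm, psiInv_succ w x (i := ⟨j, by omega⟩) rfl]
    refine ⟨m + if w⁻¹ ⟨j + 1, hj⟩ < w⁻¹ ⟨j, by omega⟩ then 1 else 0, ?_⟩
    push_cast
    ring

theorem psiInv_mem_cube_and_psi_eq_iff {n : ℕ} {w : Equiv.Perm (Fin n)} {x : Fin n → ℝ}
    (hx : x ∈ interior (nabla w)) :
    psiInv w x ∈ cube n ∧ ∀ y ∈ cube n, psi y = x ↔ psiInv w x = y := by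
  obtain ⟨h01, hlt⟩ := interior_nabla hx
  have hstep : ∀ i j : Fin n, j.val = i.val + 1 → 0 < psiInv w x j ∧ psiInv w x j < 1 := by
    intro i j hij
    have hne : w⁻¹ i ≠ w⁻¹ j := fun h => by
      have := congrArg Fin.val (w⁻¹.injective h)
      omega
    have hi := h01 i
    have hj := h01 j
    rw [psiInv_succ w x hij]
    split_ifs with h
    · have := hlt j i h
      constructor <;> linarith
    · have := hlt i j (lt_of_le_of_ne (not_lt.1 h) hne)
      constructor <;> linarith
  have hz : ∀ j, 0 < psiInv w x j ∧ psiInv w x j < 1 := by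
    intro j
    rcases eq_zero_or_succ j with hj | ⟨i, hij⟩
    · rw [psiInv_zero w x hj]
      exact h01 j
    · exact hstep i j hij
  refine ⟨fun j => ⟨(hz j).1.le, (hz j).2.le⟩, fun y hy => ⟨fun h => ?_, ?_⟩⟩
  · -- both `y` and `psiInv w x` have partial sums congruent to `x` modulo `1`, so corresponding
    -- coordinates differ by an integer; as they lie in `[0,1]` and `(0,1)`, they are equal
    have hint : ∀ j : Fin n, ∃ m : ℤ,
        ∑ k ∈ Finset.Iic j, y k = ∑ k ∈ Finset.Iic j, psiInv w x k + m := by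
      intro j
      obtain ⟨m, hm⟩ := exists_sum_Iic_psiInv w x j
      have hj : Int.fract (∑ k ∈ Finset.Iic j, y k) = x j := congrFun h j
      refine ⟨⌊∑ k ∈ Finset.Iic j, y k⌋ - m, ?_⟩
      rw [hm, ← hj]
      push_cast
      rw [Int.fract]
      ring
    have heq : ∀ j, ∃ m : ℤ, y j = psiInv w x j + m := by
      intro j
      rcases eq_zero_or_succ j with hj | ⟨i, hij⟩
      · obtain ⟨m, hm⟩ := hint j
        rw [sum_Iic_zero _ hj, sum_Iic_zero _ hj] at hm
        exact ⟨m, hm⟩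
      · obtain ⟨m, hm⟩ := hint j
        obtain ⟨l, hl⟩ := hint i
        rw [sum_Iic_succ _ hij, sum_Iic_succ _ hij, hl] at hm
        refine ⟨m - l, ?_⟩
        push_cast
        linarith
    ext j
    obtain ⟨m, hm⟩ := heq j
    have h1 := hz j
    have h2 := hy j
    have hm1 : (-1 : ℝ) < m := by linarith
    have hm2 : (m : ℝ) < 1 := by linarith
    have : m = 0 := by
      have a1 : -1 < m := by exact_mod_cast hm1
      have a2 : m < 1 := by exact_mod_cast hm2
      omega
    rw [hm, this, Int.cast_zero, add_zero]
  · rintro rfl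
    ext j
    obtain ⟨m, hm⟩ := exists_sum_Iic_psiInv w x j
    rw [psi, hm, Int.fract_add_intCast, Int.fract_eq_self]
    exact ⟨(h01 j).1.le, (h01 j).2⟩

theorem phi_inverts_psi {n : ℕ} (w : Equiv.Perm (Fin n)) :
    ∀ x ∈ interior (nabla w), phi w x ∈ cube n ∧
      ∀ y ∈ cube n, psi y = x ↔ phi w x = reversal y := by
  intro x hx
  obtain ⟨h1, h2⟩ := psiInv_mem_cube_and_psi_eq_iff hx
  refine ⟨fun i => h1 _, fun y hy => (h2 y hy).trans ⟨fun h => by rw [phi, h], fun h => ?_⟩⟩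
  ext j
  simpa [phi, reversal] using congrFun h j.rev

/-! ### The ribbon polytope -/

/-- The order polytope of a ribbon: the points of the cube for which consecutive coordinates
decrease at the places given by `S` (in reversed order) and increase elsewhere. -/
def ribbonPolytope {n : ℕ} (S : Finset (Fin n)) : Set (Fin n → ℝ) :=
  {x | x ∈ cube n ∧ ∀ i j : Fin n, j.val = i.val + 1 →
    (j.rev ∈ S → x j ≤ x i) ∧ (j.rev ∉ S → x i ≤ x j)}

theorem nabla_subset_ribbonPolytope {n : ℕ} (w : Equiv.Perm (Fin n)) :
    nabla w ⊆ ribbonPolytope (ascentSet (w⁻¹ * Fin.revPerm)) := by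
  intro x hx
  obtain ⟨hc, hm⟩ := mem_nabla_iff.1 hx
  refine ⟨hc, fun i j hij => ?_⟩
  rw [rev_mem_ascentSet_iff w hij]
  exact ⟨fun h => hm _ _ h.le, fun h => hm _ _ (not_lt.1 h)⟩

/-- Ties between coordinates are broken by an auxiliary sequence whose steps `±1` have the
prescribed signs. -/
theorem exists_mem_nabla {n : ℕ} {S : Finset (Fin n)} (hS : ∀ j : Fin n, j.val = 0 → j.rev ∉ S)
    {x : Fin n → ℝ} (hx : x ∈ ribbonPolytope S) :
    ∃ w : Equiv.Perm (Fin n), ascentSet (w⁻¹ * Fin.revPerm) = S ∧ x ∈ nabla w := by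
  let t : Fin n → ℝ := fun j => ∑ i ∈ Finset.Iic j, if i.rev ∈ S then -1 else 1
  let f : Fin n → ℝ ×ₗ ℝ := fun j => toLex (x j, t j)
  have hmono := Tuple.monotone_sort f
  set w := Tuple.sort f
  have hlt : ∀ a b, f a < f b → w⁻¹ a < w⁻¹ b := by
    intro a b hab
    by_contra h
    have := hmono (not_lt.1 h)
    simp only [Function.comp_apply] at this
    rw [show w (w⁻¹ a) = a by simp, show w (w⁻¹ b) = b by simp] at this
    exact absurd hab (not_lt.2 this)
  refine ⟨w, ?_, hx.1, fun i j hij => Prod.Lex.monotone_fst _ _ (hmono hij)⟩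
  ext k
  obtain ⟨j, rfl⟩ := Fin.rev_surjective k
  rcases eq_zero_or_succ j with hj | ⟨i, hij⟩
  · exact iff_of_false (rev_notMem_ascentSet _ hj) (hS j hj)
  · have ht : t j = t i + if j.rev ∈ S then -1 else 1 := sum_Iic_succ _ hij
    rw [rev_mem_ascentSet_iff w hij]
    obtain ⟨h1, h2⟩ := hx.2 i j hij
    constructor
    · intro h
      by_contra hj
      refine absurd h (not_lt.2 (hlt i j ?_).le)
      rw [if_neg hj] at ht
      rw [Prod.Lex.toLex_lt_toLex]
      rcases (h2 hj).lt_or_eq with h | h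
      · exact Or.inl h
      · exact Or.inr ⟨h, by simp only; linarith⟩
    · intro hj
      refine hlt j i ?_
      rw [if_pos hj] at ht
      rw [Prod.Lex.toLex_lt_toLex]
      rcases (h1 hj).lt_or_eq with h | h
      · exact Or.inl h
      · exact Or.inr ⟨h, by simp only; linarith⟩

theorem convex_ribbonPolytope {n : ℕ} (S : Finset (Fin n)) : Convex ℝ (ribbonPolytope S) := by
  rintro x ⟨hx, hx'⟩ y ⟨hy, hy'⟩ s t hs ht hst
  refine ⟨fun i => ?_, fun i j hij => ⟨fun h => ?_, fun h => ?_⟩⟩ <;>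
    simp only [Pi.add_apply, Pi.smul_apply, smul_eq_mul]
  · have h1 := hx i
    have h2 := hy i
    constructor
    · exact add_nonneg (mul_nonneg hs h1.1) (mul_nonneg ht h2.1)
    · calc s * x i + t * y i ≤ s * 1 + t * 1 :=
          add_le_add (mul_le_mul_of_nonneg_left h1.2 hs) (mul_le_mul_of_nonneg_left h2.2 ht)
        _ = 1 := by linarith
  · exact add_le_add (mul_le_mul_of_nonneg_left ((hx' i j hij).1 h) hs)
      (mul_le_mul_of_nonneg_left ((hy' i j hij).1 h) ht)
  · exact add_le_add (mul_le_mul_of_nonneg_left ((hx' i j hij).2 h) hs)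
      (mul_le_mul_of_nonneg_left ((hy' i j hij).2 h) ht)

/-- The sets whose tail counts exceed those of `S` by at most one: the feasible sets of the linked
symmetric snake with lower label `S`. -/
def ribbonSets {n : ℕ} (S : Finset (Fin n)) : Set (Finset (Fin n)) :=
  {A | ∀ m < n, tailCount S m ≤ tailCount A m ∧ tailCount A m ≤ tailCount S m + 1}

theorem indicatorVec_mem_image_ribbonPolytope {n : ℕ} {S A : Finset (Fin n)}
    (hA : A ∈ ribbonSets S) : indicatorVec A ∈ ribbonMap S '' ribbonPolytope S := by
  refine ⟨tailEquiv n (indicatorVec A - indicatorVec S), ⟨fun i => ?_, fun i j hij => ?_⟩, ?_⟩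
  · obtain ⟨h1, h2⟩ := hA i.rev.val i.rev.isLt
    rw [map_sub, Pi.sub_apply, tailEquiv_indicatorVec, tailEquiv_indicatorVec]
    have h1' : (tailCount S i.rev.val : ℝ) ≤ tailCount A i.rev.val := by exact_mod_cast h1
    have h2' : (tailCount A i.rev.val : ℝ) ≤ tailCount S i.rev.val + 1 := by exact_mod_cast h2
    constructor <;> linarith
  · have h := revDiff_succ (tailEquiv n (indicatorVec A - indicatorVec S)) hij
    rw [← tailEquiv_symm_apply, LinearEquiv.symm_apply_apply, Pi.sub_apply] at h
    constructor <;> intro hS <;> rw [← sub_nonneg]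
    · rw [← neg_sub, ← h]
      simp only [indicatorVec, if_pos hS]
      split_ifs <;> norm_num
    · rw [← h]
      simp only [indicatorVec, if_neg hS]
      split_ifs <;> norm_num
  · rw [ribbonMap_apply, LinearEquiv.symm_apply_apply, add_sub_cancel]

theorem exists_ribbonMap_eq_indicatorVec {n : ℕ} {S : Finset (Fin n)}
    (hS : ∀ j : Fin n, j.val = 0 → j.rev ∉ S) {x : Fin n → ℝ} (hx : x ∈ ribbonPolytope S)
    (h01 : ∀ i, x i = 0 ∨ x i = 1) : ∃ A ∈ ribbonSets S, ribbonMap S x = indicatorVec A := by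
  have hy : ∀ k, ribbonMap S x k = 0 ∨ ribbonMap S x k = 1 := by
    intro k
    obtain ⟨j, rfl⟩ := Fin.rev_surjective k
    rw [ribbonMap_apply']
    rcases eq_zero_or_succ j with hj | ⟨i, hij⟩
    · rw [revDiff_zero x hj, indicatorVec, if_neg (hS j hj), zero_add]
      exact h01 j
    · rw [revDiff_succ x hij]
      obtain ⟨h1, h2⟩ := hx.2 i j hij
      by_cases hj : j.rev ∈ S
      · have := h1 hj
        rw [indicatorVec, if_pos hj]
        rcases h01 i with hi | hi <;> rcases h01 j with hj | hj <;> rw [hi, hj] at this ⊢ <;>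
          first | (norm_num; done) | norm_num at this
      · have := h2 hj
        rw [indicatorVec, if_neg hj]
        rcases h01 i with hi | hi <;> rcases h01 j with hj | hj <;> rw [hi, hj] at this ⊢ <;>
          first | (norm_num; done) | norm_num at this
  classical
  have hA : ribbonMap S x = indicatorVec (Finset.univ.filter fun i => ribbonMap S x i = 1) := by
    ext k
    simp only [indicatorVec, Finset.mem_filter, Finset.mem_univ, true_and]
    rcases hy k with h | h <;> rw [h] <;> norm_num
  refine ⟨_, fun m hm => ?_, hA⟩
  have ht := tailEquiv_ribbonMap S x (Fin.rev ⟨m, hm⟩)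
  rw [hA, tailEquiv_indicatorVec, Fin.rev_rev] at ht
  simp only at ht
  generalize tailCount (Finset.univ.filter fun i => ribbonMap S x i = 1) m = c at ht ⊢
  rcases h01 (Fin.rev ⟨m, hm⟩) with h | h <;> rw [h] at ht
  · rw [add_zero, Nat.cast_inj] at ht
    omega
  · have : c = tailCount S m + 1 := by exact_mod_cast ht
    omega

theorem feasiblePolytope_ribbonSets {n : ℕ} {S : Finset (Fin n)}
    (hS : ∀ j : Fin n, j.val = 0 → j.rev ∉ S) :
    feasiblePolytope (ribbonSets S) = ribbonMap S '' ribbonPolytope S := by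
  apply subset_antisymm
  · refine convexHull_min ?_ ((convex_ribbonPolytope S).affine_image (ribbonMap S).toAffineMap)
    rintro _ ⟨A, hA, rfl⟩
    exact indicatorVec_mem_image_ribbonPolytope hA
  · rintro _ ⟨x, hx, rfl⟩
    obtain ⟨w, rfl, hw⟩ := exists_mem_nabla hS hx
    rw [nabla_eq_convexHull] at hw
    have h := Set.mem_image_of_mem (ribbonMap (ascentSet (w⁻¹ * Fin.revPerm))).toAffineMap hw
    rw [AffineMap.image_convexHull] at h
    refine convexHull_mono ?_ h
    rintro _ ⟨_, ⟨k, rfl⟩, rfl⟩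
    obtain ⟨A, hA, hAe⟩ := exists_ribbonMap_eq_indicatorVec hS
      (nabla_subset_ribbonPolytope w (nablaVertex_mem w k)) (nablaVertex_eq w k)
    exact ⟨A, hA, hAe.symm⟩

/-! ### The triangulation -/

theorem isLatticeSimplex_phiNabla {n : ℕ} (w : Equiv.Perm (Fin n)) :
    IsLatticeSimplex (phiNabla w) := by
  have hS : ∀ j : Fin n, j.val = 0 → j.rev ∉ ascentSet (w⁻¹ * Fin.revPerm) :=
    fun j hj => rev_notMem_ascentSet _ hj
  refine ⟨(ribbonMap (ascentSet (w⁻¹ * Fin.revPerm))).toAffineMap ∘ nablaVertex w,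
    (affineIndependent_nablaVertex w).map' _ (AffineEquiv.injective _), fun k i => ?_, ?_⟩
  · obtain ⟨A, -, hA⟩ := exists_ribbonMap_eq_indicatorVec hS
      (nabla_subset_ribbonPolytope w (nablaVertex_mem w k)) (nablaVertex_eq w k)
    refine ⟨if i ∈ A then 1 else 0, ?_⟩
    have := congrFun hA i
    simp only [Function.comp_apply, AffineEquiv.coe_toAffineMap]
    rw [this, indicatorVec]
    push_cast
    rfl
  · rw [phiNabla_eq, nabla_eq_convexHull, Set.range_comp, ← AffineMap.image_convexHull]
    rfl

open scoped Pointwise in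
theorem volume_phiNabla {n : ℕ} (w : Equiv.Perm (Fin n)) :
    MeasureTheory.volume (phiNabla w) = ENNReal.ofReal (1 / (n.factorial : ℝ)) := by
  have h : phiNabla w = indicatorVec (ascentSet (w⁻¹ * Fin.revPerm)) +ᵥ
      ((tailEquiv n).symm '' nabla w) := by
    rw [phiNabla_eq, ← Set.image_vadd, Set.image_image]
    rfl
  rw [h, MeasureTheory.measure_vadd, volume_tailEquiv_symm_image, volume_nabla]

/-- The inequalities of `∇_v` that are reversed in `∇_w` add up to a linear functional which
supports `∇_w` along the common face. It is transported through the affine piece of `φ` by means of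
tail sums. -/
theorem isExposed_inter_phiNabla {n : ℕ} {v w : Equiv.Perm (Fin n)}
    (h : ascentSet (v⁻¹ * Fin.revPerm) = ascentSet (w⁻¹ * Fin.revPerm)) :
    IsExposed ℝ (phiNabla w) (phiNabla w ∩ phiNabla v) := by
  intro _
  rw [phiNabla_eq, phiNabla_eq, h]
  set S := ascentSet (w⁻¹ * Fin.revPerm)
  rw [← Set.image_inter (ribbonMap S).injective]
  classical
  let I : Finset (Fin n × Fin n) :=
    Finset.univ.filter fun p => w⁻¹ p.1 ≤ w⁻¹ p.2 ∧ v⁻¹ p.2 ≤ v⁻¹ p.1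
  let l₀ : (Fin n → ℝ) →ₗ[ℝ] ℝ :=
    (∑ p ∈ I, ((LinearMap.proj p.1 : (Fin n → ℝ) →ₗ[ℝ] ℝ) - LinearMap.proj p.2)) ∘ₗ
      (tailEquiv n : (Fin n → ℝ) →ₗ[ℝ] (Fin n → ℝ))
  let c : ℝ := ∑ p ∈ I, ((tailCount S p.1.rev.val : ℝ) - tailCount S p.2.rev.val)
  have hl : ∀ x, l₀ (ribbonMap S x) = c + ∑ p ∈ I, (x p.1 - x p.2) := by
    intro x
    simp only [l₀, c, LinearMap.comp_apply, LinearMap.sum_apply, LinearMap.sub_apply,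
      LinearMap.proj_apply, LinearEquiv.coe_coe, tailEquiv_ribbonMap]
    rw [← Finset.sum_add_distrib]
    exact Finset.sum_congr rfl fun p _ => by ring
  have hneg : ∀ x ∈ nabla w, ∀ p ∈ I, x p.1 - x p.2 ≤ 0 := by
    intro x hx p hp
    simp only [I, Finset.mem_filter, Finset.mem_univ, true_and] at hp
    exact sub_nonpos.2 ((mem_nabla_iff.1 hx).2 _ _ hp.1)
  refine ⟨LinearMap.toContinuousLinearMap l₀, ?_⟩
  ext y
  simp only [LinearMap.coe_toContinuousLinearMap', Set.mem_ofPred_eq]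
  constructor
  · rintro ⟨x, ⟨hw, hv⟩, rfl⟩
    refine ⟨⟨x, hw, rfl⟩, ?_⟩
    rintro _ ⟨z, hz, rfl⟩
    rw [hl, hl, add_le_add_iff_left]
    refine (Finset.sum_nonpos (hneg z hz)).trans (Finset.sum_nonneg fun p hp => ?_)
    simp only [I, Finset.mem_filter, Finset.mem_univ, true_and] at hp
    exact sub_nonneg.2 ((mem_nabla_iff.1 hv).2 _ _ hp.2)
  · rintro ⟨⟨x, hw, rfl⟩, hmax⟩
    refine ⟨x, ⟨hw, mem_nabla_iff.2 ⟨hw.1, fun a b hab => ?_⟩⟩, rfl⟩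
    -- the maximum of the functional is its value at the vertex `0` of `∇_w`
    have h0 : (0 : Fin n → ℝ) ∈ nabla w :=
      mem_nabla_iff.2 ⟨fun _ => ⟨le_rfl, zero_le_one⟩, fun _ _ _ => le_rfl⟩
    have h1 := hmax _ ⟨0, h0, rfl⟩
    rw [hl, hl, add_le_add_iff_left] at h1
    simp only [Pi.zero_apply, sub_self, Finset.sum_const_zero] at h1
    have h2 := (Finset.sum_eq_zero_iff_of_nonpos (hneg x hw)).1
      (le_antisymm (Finset.sum_nonpos (hneg x hw)) h1)
    rcases le_total (w⁻¹ a) (w⁻¹ b) with h3 | h3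
    · exact (mem_nabla_iff.1 hw).2 _ _ h3
    · have := h2 (b, a) (by
        simp only [I, Finset.mem_filter, Finset.mem_univ, true_and]
        exact ⟨h3, hab⟩)
      simp only at this
      linarith

theorem image_ribbonPolytope_eq_sUnion {n : ℕ} {S : Finset (Fin n)}
    (hS : ∀ j : Fin n, j.val = 0 → j.rev ∉ S) :
    ⋃₀ (phiNabla '' {w : Equiv.Perm (Fin n) | ascentSet (w⁻¹ * Fin.revPerm) = S}) =
      ribbonMap S '' ribbonPolytope S := by
  rw [Set.sUnion_image]
  ext y
  simp only [Set.mem_iUnion, Set.mem_ofPred_eq, exists_prop]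
  constructor
  · rintro ⟨w, rfl, hy⟩
    rw [phiNabla_eq] at hy
    exact Set.image_mono (nabla_subset_ribbonPolytope w) hy
  · rintro ⟨x, hx, rfl⟩
    obtain ⟨w, rfl, hw⟩ := exists_mem_nabla hS hx
    exact ⟨w, rfl, by rw [phiNabla_eq]; exact ⟨x, hw, rfl⟩⟩

theorem isUnimodularTriangulation_phiNabla {n : ℕ} {S : Finset (Fin n)}
    (hS : ∀ j : Fin n, j.val = 0 → j.rev ∉ S) :
    IsUnimodularTriangulation (feasiblePolytope (ribbonSets S))
      (phiNabla '' {w : Equiv.Perm (Fin n) | ascentSet (w⁻¹ * Fin.revPerm) = S}) where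
  dim_eq := by
    -- the polytope contains one of the simplices, whose affine span is the whole space
    have h0 : (0 : Fin n → ℝ) ∈ ribbonPolytope S :=
      ⟨fun _ => ⟨le_rfl, zero_le_one⟩, fun _ _ _ => ⟨fun _ => le_rfl, fun _ => le_rfl⟩⟩
    obtain ⟨w, hw, -⟩ := exists_mem_nabla hS h0
    obtain ⟨v, hv, -, he⟩ := isLatticeSimplex_phiNabla w
    have htop : affineSpan ℝ (Set.range v) = ⊤ :=
      hv.affineSpan_eq_top_iff_card_eq_finrank_add_one.2 (by simp)
    have hsub : Set.range v ⊆ feasiblePolytope (ribbonSets S) := by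
      rw [feasiblePolytope_ribbonSets hS, ← image_ribbonPolytope_eq_sUnion hS]
      exact ((subset_convexHull ℝ _).trans he.ge).trans (Set.subset_sUnion_of_mem ⟨w, hw, rfl⟩)
    rw [top_le_iff.1 (htop.ge.trans (affineSpan_mono ℝ hsub)), AffineSubspace.direction_top,
      finrank_top, Module.finrank_fin_fun]
  finite := Set.toFinite _
  simplex := by
    rintro _ ⟨w, -, rfl⟩
    exact isLatticeSimplex_phiNabla w
  volume_eq := by
    rintro _ ⟨w, -, rfl⟩
    exact volume_phiNabla w
  union_eq := by
    rw [feasiblePolytope_ribbonSets hS, image_ribbonPolytope_eq_sUnion hS]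
  inter_face := by
    rintro _ ⟨w, hw, rfl⟩ _ ⟨v, hv, rfl⟩
    refine ⟨isExposed_inter_phiNabla (hv.trans hw.symm), ?_⟩
    rw [Set.inter_comm]
    exact isExposed_inter_phiNabla (hw.trans hv.symm)

/-- The tail sums of the image of the centre of `∇_w` have integer parts given by the ascent set,
so that the centre is mapped into the polytope of `S` only if the ascent set is `S`. -/
theorem phiNabla_subset_iff {n : ℕ} {S : Finset (Fin n)}
    (hS : ∀ j : Fin n, j.val = 0 → j.rev ∉ S) (w : Equiv.Perm (Fin n)) :
    phiNabla w ⊆ feasiblePolytope (ribbonSets S) ↔ ascentSet (w⁻¹ * Fin.revPerm) = S := by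
  rw [feasiblePolytope_ribbonSets hS, phiNabla_eq]
  constructor
  · intro h
    obtain ⟨x, hx, hxe⟩ := h ⟨_, nablaCenter_mem w, rfl⟩
    refine tailCount_injective fun m => ?_
    rcases lt_or_ge m n with hm | hm
    · have ht := tailEquiv_ribbonMap S x (Fin.rev ⟨m, hm⟩)
      rw [hxe, tailEquiv_ribbonMap, Fin.rev_rev] at ht
      simp only at ht
      have h1 := hx.1 (Fin.rev ⟨m, hm⟩)
      have h2 := nablaCenter_pos w (Fin.rev ⟨m, hm⟩)
      have h3 := nablaCenter_lt_one w (Fin.rev ⟨m, hm⟩)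
      generalize tailCount (ascentSet (w⁻¹ * Fin.revPerm)) m = c at ht ⊢
      have h4 : (c : ℝ) < tailCount S m + 1 := by linarith
      have h5 : (tailCount S m : ℝ) < c + 1 := by linarith
      have h6 : c < tailCount S m + 1 := by exact_mod_cast h4
      have h7 : tailCount S m < c + 1 := by exact_mod_cast h5
      omega
    · rw [tailCount_eq_zero _ hm, tailCount_eq_zero _ hm]
  · rintro rfl
    exact Set.image_mono (nabla_subset_ribbonPolytope w)

theorem bijOn_phiNabla {n : ℕ} (S : Finset (Fin n)) :
    Set.BijOn (fun u : Equiv.Perm (Fin n) => phiNabla (Fin.revPerm * u⁻¹))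
      {u : Equiv.Perm (Fin n) | ascentSet u = S}
      (phiNabla '' {w : Equiv.Perm (Fin n) | ascentSet (w⁻¹ * Fin.revPerm) = S}) := by
  have hu : ∀ u : Equiv.Perm (Fin n), (Fin.revPerm * u⁻¹)⁻¹ * Fin.revPerm = u := by
    intro u
    rw [mul_inv_rev, inv_inv, mul_assoc, inv_mul_cancel, mul_one]
  refine ⟨fun u hmem => ⟨_, ?_, rfl⟩, fun u hmem v hv he => ?_, ?_⟩
  · rw [Set.mem_ofPred_eq, hu]
    exact hmem
  · simp only [phiNabla_eq, hu] at he
    rw [Set.mem_ofPred_eq] at hmem hv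
    rw [hmem, hv] at he
    have := nabla_injective ((ribbonMap S).injective.image_injective he)
    exact inv_injective (mul_left_cancel this)
  · rintro _ ⟨w, hw, rfl⟩
    refine ⟨w⁻¹ * Fin.revPerm, hw, ?_⟩
    simp only
    rw [mul_inv_rev, inv_inv, mul_inv_cancel_left]

/-! ### The feasible sets of linked symmetric snakes -/

theorem pathFeasible_eq_ribbonSets {n : ℕ} {p q : SymmetricPath n}
    (h : ∀ m < n, tailCount q.label m = tailCount p.label m + 1) :
    pathFeasible p q = ribbonSets p.label := by
  ext A
  rw [mem_pathFeasible_iff]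
  refine ⟨fun hA m hm => by rw [← h m hm]; exact hA m, fun hA m => ?_⟩
  rcases lt_or_ge m n with hm | hm
  · rw [h m hm]
    exact hA m hm
  · rw [tailCount_eq_zero _ hm, tailCount_eq_zero _ hm, tailCount_eq_zero _ hm]
    exact ⟨le_rfl, le_rfl⟩

theorem pathFeasible_eq_galeFeasible {n : ℕ} (p q : SymmetricPath n) :
    pathFeasible p q = galeFeasible p.label q.label := by
  ext A
  rw [mem_pathFeasible_iff, galeFeasible, Set.mem_ofPred_eq, galeLE_iff, galeLE_iff, forall_and]

end SnakePath

theorem theorem2 (n : ℕ) (hn : 0 < n) :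
    -- `φ` is `r ∘ ψ⁻¹`: on the interior of each `∇_w`, the piece `phi w` inverts `ψ` up to reversal
    (∀ w : Equiv.Perm (Fin n), ∀ x ∈ interior (SnakePath.nabla w),
      SnakePath.phi w x ∈ SnakePath.cube n ∧
      ∀ y ∈ SnakePath.cube n,
        SnakePath.psi y = x ↔ SnakePath.phi w x = SnakePath.reversal y) ∧
    -- the linked symmetric snake paths are given by the intervals `[S, S ∪ {n}]`, `S ⊆ [n - 1]`
    (∀ S : Finset (Fin n), (⟨n - 1, Nat.sub_lt hn Nat.one_pos⟩ : Fin n) ∉ S →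
      ∃ p q : SnakePath.SymmetricPath n,
        SnakePath.IsSymmetricSnake p q ∧ SnakePath.IsLinked p q ∧ p.label = S) ∧
    ∀ p q : SnakePath.SymmetricPath n,
      SnakePath.IsSymmetricSnake p q → SnakePath.IsLinked p q →
      ∃ S : Finset (Fin n),
        (⟨n - 1, Nat.sub_lt hn Nat.one_pos⟩ : Fin n) ∉ S ∧
        p.label = S ∧
        q.label = insert (⟨n - 1, Nat.sub_lt hn Nat.one_pos⟩ : Fin n) S ∧
        SnakePath.pathFeasible p q =
          SnakePath.galeFeasible S
            (insert (⟨n - 1, Nat.sub_lt hn Nat.one_pos⟩ : Fin n) S) ∧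
        -- the simplices `φ(∇_w)` such that `j ↦ w⁻¹(n + 1 - j)` has ascent set `S`
        -- triangulate the feasible polytope
        SnakePath.IsUnimodularTriangulation
          (SnakePath.feasiblePolytope (SnakePath.pathFeasible p q))
          (SnakePath.phiNabla ''
            {w : Equiv.Perm (Fin n) | SnakePath.ascentSet (w⁻¹ * Fin.revPerm) = S}) ∧
        -- they are exactly the simplices `φ(∇_w)` which lie in the feasible polytope
        (∀ w : Equiv.Perm (Fin n),
          SnakePath.phiNabla w ⊆ SnakePath.feasiblePolytope (SnakePath.pathFeasible p q) ↔
            SnakePath.ascentSet (w⁻¹ * Fin.revPerm) = S) ∧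
        -- they are in bijection with the permutations `u` with ascent set `S`,
        -- through `w⁻¹(n + 1 - j) = u(j)`
        Set.BijOn (fun u : Equiv.Perm (Fin n) => SnakePath.phiNabla (Fin.revPerm * u⁻¹))
          {u : Equiv.Perm (Fin n) | SnakePath.ascentSet u = S}
          (SnakePath.phiNabla ''
            {w : Equiv.Perm (Fin n) | SnakePath.ascentSet (w⁻¹ * Fin.revPerm) = S}) := by
  refine ⟨SnakePath.phi_inverts_psi, fun S hS => ?_, fun p q hs hl => ?_⟩
  · have h := (SnakePath.snake_linked_iff hn (SnakePath.pathOfLabel S)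
      (SnakePath.pathOfLabel (insert (⟨n - 1, Nat.sub_lt hn Nat.one_pos⟩ : Fin n) S))).2
      fun m hm => by
        rw [SnakePath.label_pathOfLabel, SnakePath.label_pathOfLabel]
        exact SnakePath.tailCount_insert_last hn S hS hm
    exact ⟨_, _, h.1, h.2, SnakePath.label_pathOfLabel S⟩
  · have h := (SnakePath.snake_linked_iff hn p q).1 ⟨hs, hl⟩
    obtain ⟨hS, hq⟩ := SnakePath.label_eq_insert_of_snake_linked hn h
    have hS' : ∀ j : Fin n, j.val = 0 → j.rev ∉ p.label := by
      intro j hj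
      have : j.rev = ⟨n - 1, Nat.sub_lt hn Nat.one_pos⟩ := by
        ext
        rw [Fin.val_rev, hj]
      rwa [this]
    refine ⟨p.label, hS, rfl, hq, ?_, ?_, ?_, SnakePath.bijOn_phiNabla _⟩
    · rw [← hq]
      exact SnakePath.pathFeasible_eq_galeFeasible p q
    · rw [SnakePath.pathFeasible_eq_ribbonSets h]
      exact SnakePath.isUnimodularTriangulation_phiNabla hS'
    · rw [SnakePath.pathFeasible_eq_ribbonSets h]
      exact SnakePath.phiNabla_subset_iff hS'
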